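/- A geometric complete multipartite graph $H$ is a complete multipartite graph on a finite vertex set $V(H)$, with a vertex coloring $\phi:V(H)\to\mathbb{N}$ whose color classes are the partition classes (so two vertices are adjacent if and only if their colors differ), whose vertices are distinct points of the plane in general position (no three on a line) and whose edges are drawn as straight-line segments. A cycle in $H$ is plane if no two of its edges cross, and non-rainbow if it contains two distinct vertices of the same color. Consider the following configurations in $H$. - $\mathcal{C}_1$: four distinct vertices $u,u',v,v'$ and two distinct colors $\phi_1,\phi_2$ with $\phi(u)=\phi(u')=\phi_1$ and $\phi(v)=\phi(v')=\phi_2$, such that $v$ and $v'$ lie on different sides of the straight line through $u$ and $u'$. - $\mathcal{C}_2$: four distinct vertices $u,u',v,v'$ and three distinct colors $\phi_1,\phi_2,\phi_3$ with $\phi(u)=\phi(u')=\phi_1$, $\phi(v)=\phi_2$ and $\phi(v')=\phi_3$, such that $v$ and $v'$ lie on different sides of the straight line through $u$ and $u'$. - $\mathcal{C}_3$: four distinct vertices $u,u',v,v'$ and three distinct colors $\phi_1,\phi_2,\phi_3$ with $\phi(u)=\phi_1$, $\phi(u')=\phi_2$ and $\phi(v)=\phi(v')=\phi_3$, such that $v$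 and $v'$ lie on different sides of the straight line through $u$ and $u'$. - $\mathcal{C}_4$: five distinct vertices $u,u',v,v',w$ and four distinct colors $\phi_1,\dots,\phi_4$ with $\phi(u)=\phi(u')=\phi_1$, $\phi(v)=\phi_2$, $\phi(v')=\phi_3$ and $\phi(w)=\phi_4$, such that $u,u',v,v'$ are the corners of a convex quadrilateral (in some cyclic order) with $w$ in its interior. **Theorem.** A geometric complete multipartite graph $H$ contains a non-rainbow plane cycle if and only if it contains at least one of the configurations $\mathcal{C}_1$, $\mathcal{C}_2$, $\mathcal{C}_3$, $\mathcal{C}_4$. Moreover, there is an algorithm (a single real RAM program with unit-cost instructions, whose input is the list of the vertices of $H$ with their coordinates and colors) that decides whether $H$ has a non-rainbow plane cycle in time $O(|V(H)|^5)$. -/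

import Mathlib

/-! ### Geometric graphs -/

/-- The Euclidean plane. -/
abbrev Plane : Type := EuclideanSpace ℝ (Fin 2)

/-- A geometric graph: a graph whose vertices are distinct points of the plane in general position
(no three on a line); the edge `uv` is drawn as the segment joining the points of `u` and `v`. -/
structure GeometricGraph (V : Type*) where
  /-- the abstract graph -/
  graph : SimpleGraph V
  /-- the positions of the vertices -/
  pos : V → Plane
  pos_injective : Function.Injective pos
  general_position : ∀ u v w : V, u ≠ v → u ≠ w → v ≠ w →
    ¬ Collinear ℝ {pos u, pos v, pos w}

namespace GeometricGraph

variable {V : Type*}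

/-- A subdrawing is plane if no two of its edges cross, that is, the relative interiors of any two
distinct edges are disjoint. -/
def IsPlane (D : GeometricGraph V) (S : D.graph.Subgraph) : Prop :=
  ∀ a b c d : V, S.Adj a b → S.Adj c d → s(a, b) ≠ s(c, d) →
    Disjoint (openSegment ℝ (D.pos a) (D.pos b)) (openSegment ℝ (D.pos c) (D.pos d))

/-- The vertices `v` and `v'` lie (strictly) on different sides of the straight line through
`u` and `u'`. -/
def Separates (D : GeometricGraph V) (u u' v v' : V) : Prop :=
  (line[ℝ, D.pos u, D.pos u']).SOppSide (D.pos v) (D.pos v')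

end GeometricGraph

/-- A geometric complete multipartite graph, with the vertex coloring whose color classes are the
partition classes: two vertices are adjacent exactly when their colors differ. -/
structure GeometricCompleteMultipartiteGraph (V : Type*) extends GeometricGraph V where
  /-- the vertex coloring -/
  color : V → ℕ
  adj_iff : ∀ u v : V, graph.Adj u v ↔ color u ≠ color v

namespace GeometricCompleteMultipartiteGraph

variable {V : Type*}

/-- `H` contains a plane cycle on which two distinct vertices have the same color. -/
def HasNonRainbowPlaneCycle (H : GeometricCompleteMultipartiteGraph V) : Prop :=
  ∃ (x : V) (C : H.graph.Walk x x), C.IsCycle ∧ H.IsPlane C.toSubgraph ∧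
    ∃ a ∈ C.support, ∃ b ∈ C.support, a ≠ b ∧ H.color a = H.color b

/-- Configuration `C₁`: two colors; the line through two vertices of one color separates two
vertices of the other color. -/
def ContainsC1 (H : GeometricCompleteMultipartiteGraph V) : Prop :=
  ∃ u u' v v' : V, [u, u', v, v'].Nodup ∧
    H.color u = H.color u' ∧ H.color v = H.color v' ∧
    H.color u ≠ H.color v ∧
    H.Separates u u' v v'

/-- Configuration `C₂`: three colors; the line through two vertices of one color separates two
vertices of the two other colors. -/
def ContainsC2 (H : GeometricCompleteMultipartiteGraph V) : Prop :=
  ∃ u u' v v' : V, [u, u', v, v'].Nodup ∧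
    H.color u = H.color u' ∧
    [H.color u, H.color v, H.color v'].Nodup ∧
    H.Separates u u' v v'

/-- Configuration `C₃`: three colors; the line through two vertices of different colors separates
two vertices of the third color. -/
def ContainsC3 (H : GeometricCompleteMultipartiteGraph V) : Prop :=
  ∃ u u' v v' : V, [u, u', v, v'].Nodup ∧
    H.color v = H.color v' ∧
    [H.color u, H.color u', H.color v].Nodup ∧
    H.Separates u u' v v'

/-- Configuration `C₄`: four colors; two vertices of one color and one vertex of each of two other
colors are the corners of a convex quadrilateral (in any cyclic order) that has a vertex of the
fourth color in its interior. -/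
def ContainsC4 (H : GeometricCompleteMultipartiteGraph V) : Prop :=
  ∃ u u' v v' w : V, [u, u', v, v', w].Nodup ∧
    H.color u = H.color u' ∧
    [H.color u, H.color v, H.color v', H.color w].Nodup ∧
    ConvexIndependent ℝ ![H.pos u, H.pos u', H.pos v, H.pos v'] ∧
    H.pos w ∈ interior (convexHull ℝ {H.pos u, H.pos u', H.pos v, H.pos v'})

end GeometricCompleteMultipartiteGraph

/-! ### The real RAM

A real random access machine has registers and an unbounded array for natural numbers, registers
and an unbounded array for real numbers, and a finite program. Array cells are addressed through
natural number registers. Every instruction takes unit time. -/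

namespace RealRAM

/-- Basic instructions. The numbers `d`, `a`, `b` are register numbers fixed in the program. -/
inductive Op : Type
  /-- `N d := c` -/
  | natConst (d c : ℕ)
  /-- `N d := N a` -/
  | natCopy (d a : ℕ)
  /-- `N d := N a + N b` -/
  | natAdd (d a b : ℕ)
  /-- `N d := N a - N b` (truncated at `0`) -/
  | natSub (d a b : ℕ)
  /-- `N d := natMem[N a]` -/
  | natLoad (d a : ℕ)
  /-- `natMem[N d] := N a` -/
  | natStore (d a : ℕ)
  /-- `R d := c`, for an integer constant `c` -/
  | realConst (d : ℕ) (c : ℤ)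
  /-- `R d := R a` -/
  | realCopy (d a : ℕ)
  /-- `R d := R a + R b` -/
  | realAdd (d a b : ℕ)
  /-- `R d := R a - R b` -/
  | realSub (d a b : ℕ)
  /-- `R d := R a * R b` -/
  | realMul (d a b : ℕ)
  /-- `R d := R a / R b` (with value `0` for a division by `0`) -/
  | realDiv (d a b : ℕ)
  /-- `R d := realMem[N a]` -/
  | realLoad (d a : ℕ)
  /-- `realMem[N d] := R a` -/
  | realStore (d a : ℕ)

/-- Tests: comparison of two registers. -/
inductive Test : Type
  | natEq (a b : ℕ)
  | natLt (a b : ℕ)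
  | realEq (a b : ℕ)
  | realLt (a b : ℕ)

/-- Programs, built from basic instructions with sequencing, branching and loops. -/
inductive Prog : Type
  | op (o : Op)
  | seq (p q : Prog)
  | ite (c : Test) (p q : Prog)
  | while (c : Test) (p : Prog)

/-- The contents of the registers and arrays. -/
structure Store : Type where
  /-- natural number registers -/
  N : ℕ → ℕ
  /-- real number registers -/
  R : ℕ → ℝ
  /-- natural number array -/
  natMem : ℕ → ℕ
  /-- real number array -/
  realMem : ℕ → ℝ

/-- The effect of a basic instruction. -/
noncomputable def Op.exec (s : Store) : Op → Store
  | .natConst d c => { s with N := Function.update s.N d c }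
  | .natCopy d a => { s with N := Function.update s.N d (s.N a) }
  | .natAdd d a b => { s with N := Function.update s.N d (s.N a + s.N b) }
  | .natSub d a b => { s with N := Function.update s.N d (s.N a - s.N b) }
  | .natLoad d a => { s with N := Function.update s.N d (s.natMem (s.N a)) }
  | .natStore d a => { s with natMem := Function.update s.natMem (s.N d) (s.N a) }
  | .realConst d c => { s with R := Function.update s.R d (c : ℝ) }
  | .realCopy d a => { s with R := Function.update s.R d (s.R a) }
  | .realAdd d a b => { s with R := Function.update s.R d (s.R a + s.R b) }
  | .realSub d a b => { s with R := Function.update s.R d (s.R a - s.R b) }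
  | .realMul d a b => { s with R := Function.update s.R d (s.R a * s.R b) }
  | .realDiv d a b => { s with R := Function.update s.R d (s.R a / s.R b) }
  | .realLoad d a => { s with R := Function.update s.R d (s.realMem (s.N a)) }
  | .realStore d a => { s with realMem := Function.update s.realMem (s.N d) (s.R a) }

/-- The outcome of a test. -/
def Test.holds (s : Store) : Test → Prop
  | .natEq a b => s.N a = s.N b
  | .natLt a b => s.N a < s.N b
  | .realEq a b => s.R a = s.R b
  | .realLt a b => s.R a < s.R b

/-- A configuration: the list of program parts that remain to be executed, and the store. The
machine has halted when the list is empty. -/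
abbrev Config : Type := List Prog × Store

open Classical in
/-- One time step of the machine (a halted machine does not change any more). -/
noncomputable def step : Config → Config
  | ([], s) => ([], s)
  | (.op o :: k, s) => (k, o.exec s)
  | (.seq p q :: k, s) => (p :: q :: k, s)
  | (.ite c p q :: k, s) => if c.holds s then (p :: k, s) else (q :: k, s)
  | (.while c p :: k, s) => if c.holds s then (p :: .while c p :: k, s) else (k, s)

/-- Started on the store `s`, the program `P` halts after at most `t` time steps, with final
store `s'`. -/
def HaltsWithin (P : Prog) (s : Store) (t : ℕ) (s' : Store) : Prop :=
  step^[t] ([P], s) = ([], s')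

end RealRAM

/-- The input store that describes `H`, for an enumeration `e` of its vertices: the number `n` of
vertices is in the natural number register `0`, the color of the `i`-th vertex (`i < n`) in cell `i`
of the natural number array, and its coordinates in the cells `2 i` and `2 i + 1` of the real number
array. Everything else is `0`. -/
noncomputable def GeometricCompleteMultipartiteGraph.input {V : Type*} {n : ℕ}
    (H : GeometricCompleteMultipartiteGraph V) (e : Fin n ≃ V) : RealRAM.Store where
  N := fun r => if r = 0 then n else 0
  R := fun _ => 0
  natMem := fun i => if h : i < n then H.color (e ⟨i, h⟩) else 0
  realMem := fun j =>
    if h : j / 2 < n then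
      (if j % 2 = 0 then H.pos (e ⟨j / 2, h⟩) 0 else H.pos (e ⟨j / 2, h⟩) 1)
    else 0

/-!
# Non-rainbow plane cycles in geometric complete multipartite graphs

Each configuration contains a short plane cycle. In `C₁`, `C₂`, `C₃` the line `u u'` is a diagonal
that separates `v` from `v'`, so the 4-cycle `u v u' v'` is plane. In `C₄` either the line `u u'`
separates `v` from `v'`, with the same conclusion, or `u u'` is a side of the quadrilateral and can
be replaced by the path `u w u'`. The 5-cycle so obtained is plane even under the weaker condition
that the quadrilateral is star-shaped around `w` (`IsFourCycle`, `IsFiveCycle`).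

Conversely, consider a graph without the four configurations and two vertices `a`, `b` of one color.
Let `X` be the color class of `a` and `Y` the set of the other vertices. Without `C₁`, `C₂`, `C₃`
the sets `X` and `Y` are mutually avoiding: no line through two points of one of them separates
points of the other. Hence all points of `X` see `Y` in the same angular order, and vice versa, and
these two orders determine which pairs of edges between `X` and `Y` cross.
Moreover, three vertices of `Y` that are not all of one color bulge away from `X`, since otherwise
the middle one yields `C₄` (`IsBase.turn_pos_of_lt_of_lt`). So an edge of a plane cycle inside `Y`
joins vertices of the cycle that are consecutive in the angular order, because no edge at a vertex
in between could leave the interval, while the two ends of an edge do not separate a cycle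
(`IsBase.consecutive`). Then the first neighbor `t` of `a` on a plane cycle through `a` and `b`
separates the cycle: on one side are the vertices of `Y` after `t` together with `a` and the
vertices of `X` before `a`, on the other side is `b`. But a cycle has no cut vertex
(`IsBase.not_isPlane`). No form of the Jordan curve theorem is needed.

The decision program therefore only has to search for a 4-cycle or 5-cycle of the two types above.
Five nested loops run through all quintuples of vertices; the body is a test of constant length,
made of color comparisons and signs of `2 × 2` determinants. The statement `RealRAM.Flags` about a
program part (what it preserves, when it sets the answer register, how long it takes) is closed
under tests, sequencing and loops.
-/

/-! ### Orientation of triples of points -/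

/-- Twice the signed area of the triangle `a b c`: positive if `a, b, c` is a left turn, negative if
it is a right turn, zero if the points are collinear. -/
def orient (a b c : Plane) : ℝ :=
  (b 0 - a 0) * (c 1 - a 1) - (b 1 - a 1) * (c 0 - a 0)

theorem orient_rotate (a b c : Plane) : orient b c a = orient a b c := by
  simp only [orient]; ring

theorem orient_swap (a b c : Plane) : orient b a c = -orient a b c := by
  simp only [orient]; ring

theorem orient_swap_right (a b c : Plane) : orient a c b = -orient a b c := by
  simp only [orient]; ring

@[simp] theorem orient_self_left (a b : Plane) : orient a b a = 0 := by
  simp [orient]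

@[simp] theorem orient_self_right (a b : Plane) : orient a b b = 0 := by
  simp only [orient]; ring

@[simp] theorem orient_same (a b : Plane) : orient a a b = 0 := by
  simp [orient]

theorem orient_combo (a b p q : Plane) {s t : ℝ} (h : s + t = 1) :
    orient a b (s • p + t • q) = s * orient a b p + t * orient a b q := by
  obtain rfl : s = 1 - t := by linarith
  simp only [orient, PiLp.add_apply, PiLp.smul_apply, smul_eq_mul]
  ring

theorem continuous_orient (a b : Plane) : Continuous (orient a b) := by
  unfold orient
  fun_prop

theorem mem_line_iff_orient {a b : Plane} (hab : a ≠ b) (p : Plane) :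
    p ∈ line[ℝ, a, b] ↔ orient a b p = 0 := by
  rw [mem_affineSpan_pair_iff_exists_lineMap_eq]
  constructor
  · rintro ⟨r, rfl⟩
    rw [AffineMap.lineMap_apply_module, orient_combo _ _ _ _ (by ring)]
    simp
  · intro h
    -- project on the direction of the line
    have hpos : 0 < (b 0 - a 0) ^ 2 + (b 1 - a 1) ^ 2 := by
      by_contra hn
      apply hab
      have h0 : b 0 - a 0 = 0 := by nlinarith [sq_nonneg (b 0 - a 0), sq_nonneg (b 1 - a 1)]
      have h1 : b 1 - a 1 = 0 := by nlinarith [sq_nonneg (b 0 - a 0), sq_nonneg (b 1 - a 1)]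
      ext i
      fin_cases i
      · simp; linarith
      · simp; linarith
    refine ⟨((b 0 - a 0) * (p 0 - a 0) + (b 1 - a 1) * (p 1 - a 1)) /
      ((b 0 - a 0) ^ 2 + (b 1 - a 1) ^ 2), ?_⟩
    rw [AffineMap.lineMap_apply_module]
    unfold orient at h
    have hne := hpos.ne'
    ext i
    fin_cases i
    · simp only [Fin.zero_eta, PiLp.add_apply, PiLp.smul_apply, smul_eq_mul]
      field_simp
      linear_combination (b 1 - a 1) * h
    · simp only [Fin.mk_one, PiLp.add_apply, PiLp.smul_apply, smul_eq_mul]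
      field_simp
      linear_combination (-(b 0 - a 0)) * h

theorem collinear_of_orient_eq_zero {a b c : Plane} (hab : a ≠ b) (h : orient a b c = 0) :
    Collinear ℝ {a, b, c} := by
  have := collinear_insert_of_mem_affineSpan_pair ((mem_line_iff_orient hab c).2 h)
  rwa [show ({a, b, c} : Set Plane) = {c, a, b} by ext; simp; tauto]

theorem sOppSide_line_iff {a b : Plane} (hab : a ≠ b) (p q : Plane) :
    (line[ℝ, a, b]).SOppSide p q ↔ orient a b p * orient a b q < 0 := by
  rw [AffineSubspace.SOppSide, AffineSubspace.wOppSide_iff_exists_wbtw,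
    mem_line_iff_orient hab, mem_line_iff_orient hab]
  constructor
  · rintro ⟨⟨r, hr, t, ⟨ht0, ht1⟩, rfl⟩, hp, hq⟩
    rw [mem_line_iff_orient hab, AffineMap.lineMap_apply_module,
      orient_combo _ _ _ _ (by ring)] at hr
    rcases lt_or_gt_of_ne hp with hp | hp <;> rcases lt_or_gt_of_ne hq with hq | hq
    · rcases ht0.eq_or_lt with rfl | h0
      · exact absurd (by simpa using hr) hp.ne
      · nlinarith [mul_pos h0 (neg_pos.2 hq), mul_nonneg (sub_nonneg.2 ht1) (neg_pos.2 hp).le]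
    · exact mul_neg_of_neg_of_pos hp hq
    · exact mul_neg_of_pos_of_neg hp hq
    · rcases ht0.eq_or_lt with rfl | h0
      · exact absurd (by simpa using hr) hp.ne'
      · nlinarith [mul_pos h0 hq, mul_nonneg (sub_nonneg.2 ht1) hp.le]
  · intro h
    have hp : orient a b p ≠ 0 := fun h0 => by simp [h0] at h
    have hq : orient a b q ≠ 0 := fun h0 => by simp [h0] at h
    refine ⟨⟨AffineMap.lineMap p q (orient a b p / (orient a b p - orient a b q)), ?_, _, ?_, rfl⟩,
      hp, hq⟩
    · have hd : orient a b p - orient a b q ≠ 0 := fun h0 => by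
        rw [sub_eq_zero] at h0; rw [h0] at h; nlinarith [mul_self_nonneg (orient a b q)]
      rw [mem_line_iff_orient hab, AffineMap.lineMap_apply_module, orient_combo _ _ _ _ (by ring)]
      field_simp
      ring
    · rcases lt_or_gt_of_ne hp with hp | hp
      · have hq : 0 < orient a b q := by nlinarith
        have hd : orient a b p - orient a b q < 0 := by linarith
        exact ⟨div_nonneg_of_nonpos hp.le hd.le, (div_le_one_of_neg hd).2 (by linarith)⟩
      · have hq : orient a b q < 0 := by nlinarith
        have hd : 0 < orient a b p - orient a b q := by linarith
        exact ⟨(div_pos hp hd).le, (div_le_one hd).2 (by linarith)⟩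

/-- Two segments on different sides of the line `p q`, one of them not contained in that line, have
disjoint relative interiors. -/
theorem disjoint_openSegment_of_orient (p q : Plane) {a b c d : Plane}
    (ha : 0 ≤ orient p q a) (hb : 0 ≤ orient p q b)
    (hc : orient p q c ≤ 0) (hd : orient p q d ≤ 0)
    (h : 0 < orient p q a + orient p q b ∨ orient p q c + orient p q d < 0) :
    Disjoint (openSegment ℝ a b) (openSegment ℝ c d) := by
  rw [Set.disjoint_left]
  rintro z ⟨s, t, hs, ht, hst, rfl⟩ ⟨s', t', hs', ht', hst', h'⟩
  have e := congrArg (orient p q) h'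
  rw [orient_combo _ _ _ _ hst, orient_combo _ _ _ _ hst'] at e
  have h1 := mul_nonneg hs.le ha
  have h2 := mul_nonneg ht.le hb
  have h3 := mul_nonneg hs'.le (neg_nonneg.2 hc)
  have h4 := mul_nonneg ht'.le (neg_nonneg.2 hd)
  rcases h with h | h
  · have ea : orient p q a = 0 := by
      rcases mul_eq_zero.1 (show s * orient p q a = 0 by linarith) with h | h
      · exact absurd h hs.ne'
      · exact h
    have eb : orient p q b = 0 := by
      rcases mul_eq_zero.1 (show t * orient p q b = 0 by linarith) with h | h
      · exact absurd h ht.ne'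
      · exact h
    linarith
  · have ec : orient p q c = 0 := by
      rcases mul_eq_zero.1 (show s' * orient p q c = 0 by linarith) with h | h
      · exact absurd h hs'.ne'
      · exact h
    have ed : orient p q d = 0 := by
      rcases mul_eq_zero.1 (show t' * orient p q d = 0 by linarith) with h | h
      · exact absurd h ht'.ne'
      · exact h
    linarith

/-- Two edges with a common end point do not overlap. -/
theorem disjoint_openSegment_of_common_end {a b c : Plane} (h : orient a b c ≠ 0) :
    Disjoint (openSegment ℝ a b) (openSegment ℝ b c) := by
  rcases lt_or_gt_of_ne h with h | h
  · exact disjoint_openSegment_of_orient a b (by simp) (by simp) (by simp) h.le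
      (Or.inr (by simpa using h))
  · exact disjoint_openSegment_of_orient b a (by simp) (by simp) (by simp)
      (by rw [orient_swap]; linarith) (Or.inr (by simpa [orient_swap a b c] using h))

/-- Two segments cross if the line through each of them separates the ends of the other. -/
theorem not_disjoint_openSegment {a b c d : Plane}
    (h1 : orient a b c < 0) (h2 : 0 < orient a b d)
    (h3 : 0 < orient c d a) (h4 : orient c d b < 0) :
    ¬ Disjoint (openSegment ℝ a b) (openSegment ℝ c d) := by
  rw [Set.not_disjoint_iff]
  have e : orient a b d - orient a b c = orient c d a - orient c d b := by
    simp only [orient]; ring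
  have hD : 0 < orient a b d - orient a b c := by linarith
  refine ⟨(-orient c d b / (orient a b d - orient a b c)) • a +
      (orient c d a / (orient a b d - orient a b c)) • b,
    ⟨_, _, div_pos (by linarith) hD, div_pos h3 hD, ?_, rfl⟩,
    ⟨orient a b d / (orient a b d - orient a b c), -orient a b c / (orient a b d - orient a b c),
      div_pos h2 hD, div_pos (by linarith) hD, ?_, ?_⟩⟩
  · rw [← add_div, div_eq_one_iff_eq hD.ne']; linarith
  · rw [← add_div, div_eq_one_iff_eq hD.ne']; ring
  · have hne := hD.ne'
    ext i
    fin_cases i <;>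
    · simp only [Fin.zero_eta, Fin.mk_one, PiLp.add_apply, PiLp.smul_apply, smul_eq_mul]
      field_simp
      simp only [orient]
      ring

theorem mem_convexHull_triangle {a b c p : Plane} (h : 0 < orient a b c)
    (h1 : 0 ≤ orient a b p) (h2 : 0 ≤ orient b c p) (h3 : 0 ≤ orient c a p) :
    p ∈ convexHull ℝ {a, b, c} := by
  -- barycentric coordinates are quotients of areas
  have e : orient b c p + orient c a p + orient a b p = orient a b c := by
    simp only [orient]; ring
  refine mem_convexHull_of_exists_fintype
    ![orient b c p / orient a b c, orient c a p / orient a b c, orient a b p / orient a b c]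
    ![a, b, c] ?_ ?_ ?_ ?_
  · intro i
    fin_cases i
    · exact div_nonneg h2 h.le
    · exact div_nonneg h3 h.le
    · exact div_nonneg h1 h.le
  · simp only [Fin.sum_univ_three, Matrix.cons_val]
    rw [← add_div, ← add_div, e, div_self h.ne']
  · intro i
    fin_cases i <;> simp
  · have hne := h.ne'
    simp only [Fin.sum_univ_three, Matrix.cons_val]
    ext i
    fin_cases i <;>
    · simp only [Fin.zero_eta, Fin.mk_one, PiLp.add_apply, PiLp.smul_apply, smul_eq_mul]
      field_simp
      simp only [orient]
      ring

theorem orient_nonneg_of_mem_convexHull {a b : Plane} {s : Set Plane}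
    (h : ∀ x ∈ s, 0 ≤ orient a b x) {p : Plane} (hp : p ∈ convexHull ℝ s) :
    0 ≤ orient a b p := by
  have hc : Convex ℝ {x | 0 ≤ orient a b x} := by
    intro x hx y hy s t hs ht hst
    have hx' : 0 ≤ orient a b x := hx
    have hy' : 0 ≤ orient a b y := hy
    change 0 ≤ orient a b _
    rw [orient_combo _ _ _ _ hst]
    positivity
  exact convexHull_min h hc hp

/-! ### Cut sets of cycles -/

namespace SimpleGraph.Walk

variable {V : Type*} {G : SimpleGraph V}

theorem IsPath.mem_of_start_mem {S : Set V} {u t : V} {p : G.Walk u t} (hp : p.IsPath)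
    (hu : u ∈ S ∨ u = t)
    (h : ∀ a b, s(a, b) ∈ p.edges → a ∈ S → a ≠ t → b ∈ S ∨ b = t) :
    ∀ z ∈ p.support, z ∈ S ∨ z = t := by
  induction p with
  | nil => intro z hz; right; simpa using hz
  | @cons u v t huv q ih =>
    intro z hz
    rw [cons_isPath_iff] at hp
    have hut : u ≠ t := fun h => hp.2 (h ▸ q.end_mem_support)
    have huS : u ∈ S := hu.resolve_right hut
    rw [support_cons, List.mem_cons] at hz
    rcases hz with rfl | hz
    · exact Or.inl huS
    · exact ih hp.1 (h u v (by simp) huS hut) (fun a b hab => h a b (by simp [hab])) z hz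

/-- If the boundary of `S` in a path consists of edges ending in the last vertex `t`, then `S`
contains all or none of the other vertices of the path. -/
theorem IsPath.mem_of_boundary_subset_end {S : Set V} {u t : V} {p : G.Walk u t} (hp : p.IsPath)
    (htS : t ∉ S) (h : ∀ a b, s(a, b) ∈ p.edges → a ∈ S → b ∈ S ∨ b = t)
    {a b : V} (ha : a ∈ p.support) (haS : a ∈ S) (hb : b ∈ p.support) : b ∈ S ∨ b = t := by
  by_cases hu : u ∈ S ∨ u = t
  · exact hp.mem_of_start_mem hu (fun a b hab haS _ => h a b hab haS) b hb
  · rcases hp.mem_of_start_mem (S := Sᶜ) (Or.inl fun huS => hu (Or.inl huS))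
      (fun c d hcd hc hct => Or.inl fun hd =>
      (h d c (by rwa [Sym2.eq_swap]) hd).elim hc hct) a ha with h' | rfl
    · exact absurd haS h'
    · exact absurd haS htS

variable {x : V} {C : G.Walk x x}

/-- A vertex of a cycle is not a cut vertex: a set of vertices whose boundary consists of edges that
end in `t` contains all or none of the remaining vertices of the cycle. -/
theorem IsCycle.mem_of_boundary_subset_vertex (hC : C.IsCycle) {S : Set V} {t : V}
    (ht : t ∈ C.support) (htS : t ∉ S)
    (h : ∀ a b, C.toSubgraph.Adj a b → a ∈ S → b ∈ S ∨ b = t)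
    {a b : V} (ha : a ∈ C.support) (haS : a ∈ S) (hb : b ∈ C.support) : b ∈ S ∨ b = t := by
  classical
  obtain ⟨D, hD, hadj, hsup⟩ : ∃ D : G.Walk t t, D.IsCycle ∧
      (∀ a b, s(a, b) ∈ D.edges → C.toSubgraph.Adj a b) ∧ ∀ z, z ∈ C.support → z ∈ D.support :=
    ⟨C.rotate t ht, hC.rotate ht, fun a b hab => by
      rw [← adj_toSubgraph_iff_mem_edges, toSubgraph_rotate] at hab; exact hab,
      fun z hz => by rwa [mem_support_rotate_iff]⟩
  cases D with
  | nil => exact absurd hD (by simp)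
  | @cons _ v _ huv p =>
    rw [cons_isCycle_iff] at hD
    have key : ∀ z, z ∈ C.support → z = t ∨ z ∈ p.support := fun z hz => by
      simpa using hsup z hz
    rcases key b hb with hb | hb
    · exact Or.inr hb
    rcases key a ha with rfl | ha
    · exact absurd haS htS
    exact hD.1.mem_of_boundary_subset_end htS (fun a b hab => h a b (hadj a b (by simp [hab])))
      ha haS hb

/-- The two ends of an edge of a cycle do not separate the cycle: a set of vertices whose boundary
consists of edges that end in `y` or in `y'` contains all or none of the remaining vertices. -/
theorem IsCycle.mem_of_boundary_subset_edge (hC : C.IsCycle) {S : Set V} {y y' : V}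
    (hy : C.toSubgraph.Adj y y') (hyS : y ∉ S) (hyS' : y' ∉ S)
    (h : ∀ a b, C.toSubgraph.Adj a b → a ∈ S → b ∈ S ∨ b = y ∨ b = y')
    {a b : V} (ha : a ∈ C.support) (haS : a ∈ S) (hb : b ∈ C.support) :
    b ∈ S ∨ b = y ∨ b = y' := by
  classical
  have hyC : y ∈ C.support := by
    rw [← mem_verts_toSubgraph]; exact hy.fst_mem
  obtain ⟨D, hD, hsnd, hadj, hsup⟩ : ∃ D : G.Walk y y, D.IsCycle ∧ D.snd = y' ∧
      (∀ a b, s(a, b) ∈ D.edges → C.toSubgraph.Adj a b) ∧ ∀ z, z ∈ C.support → z ∈ D.support := by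
    have h1 := hC.rotate hyC
    have h2 : y' ∈ (C.rotate y hyC).toSubgraph.neighborSet y := by
      rw [toSubgraph_rotate]; exact hy
    have h3 : ∀ a b, s(a, b) ∈ (C.rotate y hyC).edges → C.toSubgraph.Adj a b := fun a b hab => by
      rw [← adj_toSubgraph_iff_mem_edges, toSubgraph_rotate] at hab; exact hab
    rw [h1.neighborSet_toSubgraph_endpoint] at h2
    rcases h2 with h2 | h2
    · exact ⟨_, h1, h2.symm, h3, fun z hz => by rwa [mem_support_rotate_iff]⟩
    · have h2 : y' = _ := h2
      exact ⟨_, h1.reverse, by rw [snd_reverse, h2], fun a b hab => h3 a b (by simpa using hab),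
        fun z hz => by rwa [support_reverse, List.mem_reverse, mem_support_rotate_iff]⟩
  cases D with
  | nil => exact absurd hD (by simp)
  | @cons _ v _ huv p =>
    obtain rfl : v = y' := by simpa using hsnd
    cases p with
    | nil => exact absurd rfl huv.ne
    | @cons _ w _ hvw q =>
      have hp := (cons_isPath_iff _ _).1 ((cons_isCycle_iff _ _).1 hD).1
      have key : ∀ z, z ∈ C.support → z = y ∨ z = v ∨ z ∈ q.support := fun z hz => by
        simpa using hsup z hz
      rcases key b hb with hb | hb | hb
      · exact Or.inr (Or.inl hb)
      · exact Or.inr (Or.inr hb)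
      rcases key a ha with rfl | rfl | ha
      · exact absurd haS hyS
      · exact absurd haS hyS'
      refine (hp.1.mem_of_boundary_subset_end hyS (fun a b hab haS => ?_) ha haS hb).imp_right
        Or.inl
      rcases h a b (hadj a b (by simp [hab])) haS with h' | h' | h'
      · exact Or.inl h'
      · exact Or.inr h'
      · exact absurd (q.snd_mem_support_of_mem_edges hab) (h' ▸ hp.2)

end SimpleGraph.Walk

/-! ### Convex quadrilaterals -/

theorem convexIndependent_of_orient {ι : Type*} {p : ι → Plane}
    (h : ∀ i, ∃ a b, orient a b (p i) < 0 ∧ ∀ j, j ≠ i → 0 ≤ orient a b (p j)) :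
    ConvexIndependent ℝ p := by
  rw [convexIndependent_iff_notMem_convexHull_sdiff]
  intro i s hi
  obtain ⟨a, b, hab, hj⟩ := h i
  refine absurd (orient_nonneg_of_mem_convexHull ?_ hi) (not_le.2 hab)
  rintro _ ⟨j, hjs, rfl⟩
  exact hj j hjs.2

/-- Four points all of whose cyclically ordered triples are left turns are in convex position. -/
theorem convexIndependent_quadrilateral {a b c d : Plane} (habc : 0 < orient a b c)
    (habd : 0 < orient a b d) (hacd : 0 < orient a c d) (hbcd : 0 < orient b c d) :
    ConvexIndependent ℝ ![a, b, c, d] := by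
  apply convexIndependent_of_orient
  have e1 : orient d b a < 0 := by
    rw [orient_swap, orient_rotate]; linarith
  have e2 : orient a c b < 0 := by rw [orient_swap_right]; linarith
  have e3 : orient b d c < 0 := by rw [orient_swap_right]; linarith
  have e4 : orient c a d < 0 := by rw [orient_swap]; linarith
  have e5 : 0 < orient d b c := by rwa [← orient_rotate]
  have e6 : 0 < orient b d a := by rwa [orient_rotate]
  have e7 : 0 < orient c a b := by rwa [← orient_rotate]
  intro i
  fin_cases i
  · refine ⟨d, b, e1, fun j hj => ?_⟩
    fin_cases j <;> simp_all [le_of_lt]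
  · refine ⟨a, c, e2, fun j hj => ?_⟩
    fin_cases j <;> simp_all [le_of_lt]
  · refine ⟨b, d, e3, fun j hj => ?_⟩
    fin_cases j <;> simp_all [le_of_lt]
  · refine ⟨c, a, e4, fun j hj => ?_⟩
    fin_cases j <;> simp_all [le_of_lt]

theorem mem_interior_quadrilateral {a b c d w : Plane} (habc : 0 < orient a b c)
    (hacd : 0 < orient a c d) (h1 : 0 < orient a b w) (h2 : 0 < orient b c w)
    (h3 : 0 < orient c d w) (h4 : 0 < orient d a w) :
    w ∈ interior (convexHull ℝ {a, b, c, d}) := by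
  rw [mem_interior]
  refine ⟨{p | 0 < orient a b p} ∩ {p | 0 < orient b c p} ∩ {p | 0 < orient c d p} ∩
    {p | 0 < orient d a p}, ?_, ?_, ⟨⟨⟨h1, h2⟩, h3⟩, h4⟩⟩
  · rintro p ⟨⟨⟨p1 : 0 < orient a b p, p2 : 0 < orient b c p⟩, p3 : 0 < orient c d p⟩,
      p4 : 0 < orient d a p⟩
    -- the diagonal `a c` cuts the quadrilateral into two triangles
    rcases le_total 0 (orient a c p) with h | h
    · exact convexHull_mono (by intro x; simp; tauto)
        (mem_convexHull_triangle hacd h p3.le p4.le)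
    · exact convexHull_mono (by intro x; simp; tauto)
        (mem_convexHull_triangle habc p1.le p2.le (by rw [orient_swap]; linarith))
  · have ho (x y : Plane) : IsOpen {p | 0 < orient x y p} :=
      isOpen_lt continuous_const (continuous_orient x y)
    exact (((ho _ _).inter (ho _ _)).inter (ho _ _)).inter (ho _ _)

/-! ### Orientations in geometric graphs -/

namespace GeometricGraph

variable {V : Type*} (D : GeometricGraph V)

/-- The orientation of three vertices of a geometric graph: positive for a left turn, negative for
a right turn. -/
def turn (u v w : V) : ℝ := orient (D.pos u) (D.pos v) (D.pos w)

theorem turn_rotate (u v w : V) : D.turn v w u = D.turn u v w := orient_rotate _ _ _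

theorem turn_swap (u v w : V) : D.turn v u w = -D.turn u v w := orient_swap _ _ _

theorem turn_swap_right (u v w : V) : D.turn u w v = -D.turn u v w := orient_swap_right _ _ _

theorem turn_ne_zero {u v w : V} (h1 : u ≠ v) (h2 : u ≠ w) (h3 : v ≠ w) : D.turn u v w ≠ 0 :=
  fun h => D.general_position u v w h1 h2 h3
    (collinear_of_orient_eq_zero (D.pos_injective.ne h1) h)

theorem ne_of_turn_ne_zero {u v w : V} (h : D.turn u v w ≠ 0) : u ≠ v ∧ u ≠ w ∧ v ≠ w := by
  refine ⟨?_, ?_, ?_⟩ <;> rintro rfl <;> simp [turn] at h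

theorem separates_iff {u u' : V} (h : u ≠ u') (v v' : V) :
    D.Separates u u' v v' ↔ D.turn u u' v * D.turn u u' v' < 0 :=
  sOppSide_line_iff (D.pos_injective.ne h) _ _

end GeometricGraph

namespace GeometricCompleteMultipartiteGraph

variable {V : Type*} (H : GeometricCompleteMultipartiteGraph V)

theorem ne_of_color_ne {u v : V} (h : H.color u ≠ H.color v) : u ≠ v := fun e => h (e ▸ rfl)

/-- Without `C₁` and `C₂`, a line through two vertices of one color has all vertices of other colors
on one side. -/
theorem turn_mul_pos_of_same_color (h1 : ¬ H.ContainsC1) (h2 : ¬ H.ContainsC2) {u u' v v' : V}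
    (hu : u ≠ u') (hc : H.color u = H.color u') (hv : H.color u ≠ H.color v)
    (hv' : H.color u ≠ H.color v') : 0 < H.turn u u' v * H.turn u u' v' := by
  have n1 := H.ne_of_color_ne hv
  have n2 := H.ne_of_color_ne hv'
  have n3 := H.ne_of_color_ne (hc ▸ hv)
  have n4 := H.ne_of_color_ne (hc ▸ hv')
  have e1 := H.turn_ne_zero hu n1 n3
  have e2 := H.turn_ne_zero hu n2 n4
  refine lt_of_le_of_ne (not_lt.1 fun hneg => ?_) (mul_ne_zero e1 e2).symm
  have hvv : v ≠ v' := by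
    rintro rfl
    nlinarith [mul_self_nonneg (H.turn u u' v)]
  have hs := (H.separates_iff hu v v').2 hneg
  by_cases hcv : H.color v = H.color v'
  · exact h1 ⟨u, u', v, v', by simp [*], hc, hcv, hv, hs⟩
  · exact h2 ⟨u, u', v, v', by simp [*], hc, by simp [hv, hv', hcv], hs⟩

/-- Without `C₃`, a line through two vertices of different colors has all vertices of a third color
on one side. -/
theorem turn_mul_pos_of_third_color (h3 : ¬ H.ContainsC3) {u u' v v' : V}
    (hc : H.color u ≠ H.color u') (hcv : H.color v = H.color v') (hv : H.color u ≠ H.color v)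
    (hv' : H.color u' ≠ H.color v) : 0 < H.turn u u' v * H.turn u u' v' := by
  have hu := H.ne_of_color_ne hc
  have n1 := H.ne_of_color_ne hv
  have n2 := H.ne_of_color_ne hv'
  have n3 := H.ne_of_color_ne (hcv ▸ hv)
  have n4 := H.ne_of_color_ne (hcv ▸ hv')
  have e1 := H.turn_ne_zero hu n1 n2
  have e2 := H.turn_ne_zero hu n3 n4
  refine lt_of_le_of_ne (not_lt.1 fun hneg => ?_) (mul_ne_zero e1 e2).symm
  have hvv : v ≠ v' := by
    rintro rfl
    nlinarith [mul_self_nonneg (H.turn u u' v)]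
  exact h3 ⟨u, u', v, v', by simp [*], hcv, by simp [hc, hv, hv'], (H.separates_iff hu v v').2 hneg⟩

theorem containsC4_of_turn {u u' v v' w : V} (hu : H.color u = H.color u')
    (hc : [H.color u, H.color v, H.color v', H.color w].Nodup)
    (h1 : 0 < H.turn u u' v) (h2 : 0 < H.turn u u' v') (h3 : 0 < H.turn u v v')
    (h4 : 0 < H.turn u' v v') (w1 : 0 < H.turn u u' w) (w2 : 0 < H.turn u' v w)
    (w3 : 0 < H.turn v v' w) (w4 : 0 < H.turn v' u w) : H.ContainsC4 := by
  obtain ⟨n1, n2, n3⟩ := H.ne_of_turn_ne_zero h1.ne'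
  obtain ⟨-, n4, n5⟩ := H.ne_of_turn_ne_zero h2.ne'
  obtain ⟨-, n6, n7⟩ := H.ne_of_turn_ne_zero w1.ne'
  obtain ⟨n8, n9, n10⟩ := H.ne_of_turn_ne_zero w3.ne'
  exact ⟨u, u', v, v', w, by simp [*], hu, hc, convexIndependent_quadrilateral h1 h2 h3 h4,
    mem_interior_quadrilateral h1 h3 w1 w2 w3 w4⟩

/-- The angular order of three points around `x` is transitive if they all lie on the same side of
some line through `x`. -/
theorem turn_trans {x x' y1 y2 y3 : V} (h12 : 0 < H.turn x y1 y2) (h23 : 0 < H.turn x y2 y3)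
    (hs1 : 0 < H.turn x x' y1) (hs2 : 0 < H.turn x x' y2) (hs3 : 0 < H.turn x x' y3) :
    0 < H.turn x y1 y3 := by
  have e : H.turn x y1 y3 * H.turn x x' y2 =
      H.turn x y2 y3 * H.turn x x' y1 + H.turn x y1 y2 * H.turn x x' y3 := by
    simp only [GeometricGraph.turn, orient]; ring
  have : 0 < H.turn x y1 y3 * H.turn x x' y2 := by rw [e]; positivity
  exact (pos_iff_pos_of_mul_pos this).2 hs2

end GeometricCompleteMultipartiteGraph

/-! ### Plane cycles force a configuration -/

namespace GeometricCompleteMultipartiteGraph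

variable {V : Type*} (H : GeometricCompleteMultipartiteGraph V)

theorem turn_trichotomy {a y y' : V} (hy : H.color a ≠ H.color y) (hy' : H.color a ≠ H.color y') :
    y = y' ∨ 0 < H.turn a y y' ∨ 0 < H.turn a y' y := by
  rcases eq_or_ne y y' with h | h
  · exact Or.inl h
  rcases lt_or_gt_of_ne (H.turn_ne_zero (H.ne_of_color_ne hy) (H.ne_of_color_ne hy') h) with h | h
  · right; right; rw [H.turn_swap_right]; linarith
  · exact Or.inr (Or.inl h)

theorem not_crossing {x₀ : V} {C : H.graph.Walk x₀ x₀} (hpl : H.IsPlane C.toSubgraph)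
    {p q r s : V} (hpq : C.toSubgraph.Adj p q)
    (hrs : C.toSubgraph.Adj r s) (h1 : H.turn p q r < 0) (h2 : 0 < H.turn p q s)
    (h3 : 0 < H.turn r s p) (h4 : H.turn r s q < 0) : False := by
  obtain ⟨-, n1, n2⟩ := H.ne_of_turn_ne_zero h1.ne
  refine not_disjoint_openSegment h1 h2 h3 h4 (hpl p q r s hpq hrs fun e => ?_)
  rcases Sym2.eq_iff.1 e with ⟨rfl, rfl⟩ | ⟨rfl, rfl⟩
  · exact n1 rfl
  · exact n2 rfl

/-- Vertices `a`, `b` of one color such that all vertices of other colors lie to the left of the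
line from `a` to `b`, in a graph without the configurations `C₁`, ..., `C₄`. The other vertices are
ordered by angle around `a`. -/
structure IsBase (a b : V) : Prop where
  noC1 : ¬ H.ContainsC1
  noC2 : ¬ H.ContainsC2
  noC3 : ¬ H.ContainsC3
  noC4 : ¬ H.ContainsC4
  ne : a ≠ b
  color_eq : H.color a = H.color b
  left : ∀ y, H.color a ≠ H.color y → 0 < H.turn a b y

namespace IsBase

variable {H} {a b : V} {x₀ : V} {C : H.graph.Walk x₀ x₀}

/-- A line through two vertices that do not have the color of `a` has all vertices of the color of
`a` on one side. -/
theorem turn_pos_iff (h : H.IsBase a b) {x x' y y' : V} (hx : H.color a = H.color x)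
    (hx' : H.color a = H.color x')
    (hy : H.color a ≠ H.color y) (hy' : H.color a ≠ H.color y') :
    0 < H.turn x y y' ↔ 0 < H.turn x' y y' := by
  rcases eq_or_ne y y' with rfl | hne
  · simp [GeometricGraph.turn]
  rw [← H.turn_rotate x, ← H.turn_rotate x']
  apply pos_iff_pos_of_mul_pos
  by_cases hc : H.color y = H.color y'
  · exact H.turn_mul_pos_of_same_color h.noC1 h.noC2 hne hc (hx ▸ hy.symm) (hx' ▸ hy.symm)
  · exact H.turn_mul_pos_of_third_color h.noC3 hc (hx ▸ hx') (hx ▸ hy.symm) (hx ▸ hy'.symm)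

theorem turn_same_color_pos_iff (h : H.IsBase a b) {x x' y y' : V} (hx : H.color a = H.color x)
    (hx' : H.color a = H.color x') (hy : H.color a ≠ H.color y) (hy' : H.color a ≠ H.color y') :
    0 < H.turn x x' y ↔ 0 < H.turn x x' y' := by
  rcases eq_or_ne x x' with rfl | hne
  · simp [GeometricGraph.turn]
  exact pos_iff_pos_of_mul_pos
    (H.turn_mul_pos_of_same_color h.noC1 h.noC2 hne (hx ▸ hx') (hx ▸ hy) (hx ▸ hy'))

theorem turn_trans (h : H.IsBase a b) {y1 y2 y3 : V} (hy1 : H.color a ≠ H.color y1)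
    (hy2 : H.color a ≠ H.color y2)
    (hy3 : H.color a ≠ H.color y3) (h12 : 0 < H.turn a y1 y2) (h23 : 0 < H.turn a y2 y3) :
    0 < H.turn a y1 y3 :=
  H.turn_trans h12 h23 (h.left _ hy1) (h.left _ hy2) (h.left _ hy3)

/-- Vertices that are not all of the same color bulge away from the color class of `a`: otherwise
the middle one lies inside the quadrilateral spanned by `a`, `b` and the outer two. -/
theorem turn_pos_of_lt_of_lt (h : H.IsBase a b) {y1 y2 y3 : V} (hy1 : H.color a ≠ H.color y1)
    (hy2 : H.color a ≠ H.color y2) (hy3 : H.color a ≠ H.color y3)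
    (h12 : 0 < H.turn a y1 y2) (h23 : 0 < H.turn a y2 y3)
    (hmono : ¬ (H.color y1 = H.color y2 ∧ H.color y2 = H.color y3)) : 0 < H.turn y1 y2 y3 := by
  have h13 := h.turn_trans hy1 hy2 hy3 h12 h23
  obtain ⟨-, -, n12⟩ := H.ne_of_turn_ne_zero h12.ne'
  obtain ⟨-, -, n23⟩ := H.ne_of_turn_ne_zero h23.ne'
  obtain ⟨-, -, n13⟩ := H.ne_of_turn_ne_zero h13.ne'
  by_contra hneg
  have hneg : H.turn y1 y2 y3 < 0 := lt_of_le_of_ne (not_lt.1 hneg) (H.turn_ne_zero n12 n13 n23)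
  by_cases c12 : H.color y1 = H.color y2
  · have c13 : H.color y1 ≠ H.color y3 := fun e => hmono ⟨c12, c12 ▸ e⟩
    have := H.turn_mul_pos_of_same_color h.noC1 h.noC2 n12 c12 hy1.symm c13
    rw [H.turn_rotate a] at this
    nlinarith
  by_cases c23 : H.color y2 = H.color y3
  · have := H.turn_mul_pos_of_same_color h.noC1 h.noC2 n23 c23 hy2.symm (Ne.symm c12)
    rw [H.turn_rotate a, H.turn_rotate y1] at this
    nlinarith
  by_cases c13 : H.color y1 = H.color y3
  · have := H.turn_mul_pos_of_third_color h.noC3 hy2 c13 hy1 (Ne.symm c12)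
    rw [H.turn_swap_right a y1 y2] at this
    nlinarith
  have hb {y y' : V} (hy : H.color a ≠ H.color y) (hy' : H.color a ≠ H.color y')
      (hlt : 0 < H.turn a y y') : 0 < H.turn b y y' :=
    (h.turn_pos_iff rfl h.color_eq hy hy').1 hlt
  refine h.noC4 (H.containsC4_of_turn (u := a) (u' := b) (v := y1) (v' := y3) (w := y2)
    h.color_eq ?_ (h.left _ hy1) (h.left _ hy3) h13 (hb hy1 hy3 h13) (h.left _ hy2)
    (hb hy1 hy2 h12) ?_ ?_)
  · simp [hy1, hy2, hy3, c13, c12, Ne.symm c23]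
  · rw [H.turn_swap_right]; linarith
  · rwa [← H.turn_rotate, ← H.turn_rotate] at h23

/-- Edges between the two parts are monotone with respect to the two angular orders. -/
theorem not_crossing_of_turn (h : H.IsBase a b) (hpl : H.IsPlane C.toSubgraph) {x x' y y' : V}
    (hx : H.color a = H.color x) (hx' : H.color a = H.color x')
    (hy : H.color a ≠ H.color y) (hy' : H.color a ≠ H.color y')
    (hxx : 0 < H.turn x x' y) (hyy : 0 < H.turn a y y')
    (h1 : C.toSubgraph.Adj x y) (h2 : C.toSubgraph.Adj x' y') : False := by
  refine H.not_crossing hpl h1 h2 ?_ ((h.turn_pos_iff rfl hx hy hy').1 hyy) ?_ ?_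
  · rw [H.turn_swap_right]; linarith
  · rw [H.turn_rotate]; exact (h.turn_same_color_pos_iff hx hx' hy hy').1 hxx
  · rw [H.turn_swap_right]
    have := (h.turn_pos_iff rfl hx' hy hy').1 hyy
    linarith

/-- Two edges with alternating ends in the angular order cross. -/
theorem not_crossing_of_alternating (h : H.IsBase a b) (hpl : H.IsPlane C.toSubgraph)
    {y1 y2 y3 y4 : V}
    (hy1 : H.color a ≠ H.color y1) (hy2 : H.color a ≠ H.color y2)
    (hy3 : H.color a ≠ H.color y3) (hy4 : H.color a ≠ H.color y4)
    (h12 : 0 < H.turn a y1 y2) (h23 : 0 < H.turn a y2 y3) (h34 : 0 < H.turn a y3 y4)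
    (e13 : C.toSubgraph.Adj y1 y3) (e24 : C.toSubgraph.Adj y2 y4) : False := by
  have c13 := (H.adj_iff _ _).1 e13.adj_sub
  have c24 := (H.adj_iff _ _).1 e24.adj_sub
  have h13 := h.turn_trans hy1 hy2 hy3 h12 h23
  have h24 := h.turn_trans hy2 hy3 hy4 h23 h34
  have t123 := h.turn_pos_of_lt_of_lt hy1 hy2 hy3 h12 h23 (fun e => c13 (e.1.trans e.2))
  have t134 := h.turn_pos_of_lt_of_lt hy1 hy3 hy4 h13 h34 (fun e => c13 e.1)
  have t124 := h.turn_pos_of_lt_of_lt hy1 hy2 hy4 h12 h24 (fun e => c24 e.2)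
  have t234 := h.turn_pos_of_lt_of_lt hy2 hy3 hy4 h23 h34 (fun e => c24 (e.1.trans e.2))
  refine H.not_crossing hpl e13 e24 ?_ t134 ?_ ?_
  · rw [H.turn_swap_right]; linarith
  · rwa [H.turn_rotate]
  · rw [H.turn_swap_right]; linarith

/-- An edge of a plane cycle that avoids the color of `a` joins vertices that are consecutive in the
angular order: the edges at the vertices in between could not leave the interval. -/
theorem consecutive (h : H.IsBase a b) (hC : C.IsCycle) (hpl : H.IsPlane C.toSubgraph)
    (ha : a ∈ C.support) {y y' z : V} (hy : H.color a ≠ H.color y) (hy' : H.color a ≠ H.color y')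
    (hz : H.color a ≠ H.color z) (e : C.toSubgraph.Adj y y') (hzC : z ∈ C.support)
    (h1 : 0 < H.turn a y z) (h2 : 0 < H.turn a z y') : False := by
  have cyy := (H.adj_iff _ _).1 e.adj_sub
  have key := hC.mem_of_boundary_subset_edge e
    (S := {z | H.color a ≠ H.color z ∧ 0 < H.turn a y z ∧ 0 < H.turn a z y'})
    (by simp [GeometricGraph.turn]) (by simp [GeometricGraph.turn]) ?_ hzC ⟨hz, h1, h2⟩ ha
  · rcases key with key | rfl | rfl
    · exact key.1 rfl
    · exact hy rfl
    · exact hy' rfl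
  · rintro p q hpq ⟨hp, hyp, hpy⟩
    have t := h.turn_pos_of_lt_of_lt hy hp hy' hyp hpy (fun e => cyy (e.1.trans e.2))
    by_cases hq : H.color a = H.color q
    · -- an edge to the color class of `a` crosses the edge `y y'`
      refine (H.not_crossing hpl hpq.symm e (r := y) (s := y') ?_ ?_ ?_ ?_).elim
      · rw [H.turn_swap_right]
        have := (h.turn_pos_iff rfl hq hy hp).1 hyp
        linarith
      · exact (h.turn_pos_iff rfl hq hp hy').1 hpy
      · rw [H.turn_rotate]
        exact (h.turn_pos_iff rfl hq hy hy').1 (h.turn_trans hy hp hy' hyp hpy)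
      · rw [H.turn_swap_right]; linarith
    · rcases H.turn_trichotomy hy hq with rfl | h3 | h3
      · exact Or.inr (Or.inl rfl)
      · rcases H.turn_trichotomy hq hy' with rfl | h4 | h4
        · exact Or.inr (Or.inr rfl)
        · exact Or.inl ⟨hq, h3, h4⟩
        · exact (h.not_crossing_of_alternating hpl hy hp hy' hq hyp hpy h4 e hpq).elim
      · exact (h.not_crossing_of_alternating hpl hq hy hp hy' h3 hyp hpy hpq.symm e).elim

/-- No plane cycle passes through both `a` and `b`: its first neighbor `t` of `a` would be a cut
vertex. -/
theorem not_isPlane (h : H.IsBase a b) (hC : C.IsCycle) (hpl : H.IsPlane C.toSubgraph)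
    (ha : a ∈ C.support) (hb : b ∈ C.support) : False := by
  have hadj {p q : V} (e : C.toSubgraph.Adj p q) : H.color p ≠ H.color q :=
    (H.adj_iff _ _).1 e.adj_sub
  obtain ⟨t, hat, hmin⟩ : ∃ t, C.toSubgraph.Adj a t ∧
      ∀ y, C.toSubgraph.Adj a y → y = t ∨ 0 < H.turn a t y := by
    obtain ⟨p, q, -, hpq⟩ := Set.ncard_eq_two.1 (hC.ncard_neighborSet_toSubgraph_eq_two ha)
    have hnb (y) : C.toSubgraph.Adj a y ↔ y = p ∨ y = q := by
      rw [← SimpleGraph.Subgraph.mem_neighborSet, hpq]; simp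
    have hp := (hnb p).2 (Or.inl rfl)
    have hq := (hnb q).2 (Or.inr rfl)
    rcases H.turn_trichotomy (hadj hp) (hadj hq) with e | h1 | h1
    · exact ⟨p, hp, fun y hy => Or.inl (by rcases (hnb y).1 hy with h | h <;> simp [h, e])⟩
    · exact ⟨p, hp, fun y hy => ((hnb y).1 hy).imp_right (by rintro rfl; exact h1)⟩
    · exact ⟨q, hq, fun y hy => ((hnb y).1 hy).symm.imp_right (by rintro rfl; exact h1)⟩
  have ct := hadj hat
  have htC : t ∈ C.support := by
    rw [← SimpleGraph.Walk.mem_verts_toSubgraph]; exact hat.snd_mem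
  -- the side of the cut that contains `a`: up to `a` in the color class, after `t` in the rest
  have key := hC.mem_of_boundary_subset_vertex htC
    (S := {z | (H.color a = H.color z ∧ (z = a ∨ 0 < H.turn z a t)) ∨
      (H.color a ≠ H.color z ∧ 0 < H.turn a t z)})
    (by simp [GeometricGraph.turn, ct]) ?_ ha (Or.inl ⟨rfl, Or.inl rfl⟩) hb
  · rcases key with (⟨-, rfl | h1⟩ | ⟨h1, -⟩) | rfl
    · exact h.ne rfl
    · rw [H.turn_swap] at h1
      linarith [h.left t ct]
    · exact h1 h.color_eq
    · exact ct h.color_eq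
  · rintro p q hpq (⟨hp, hp'⟩ | ⟨hp, htp⟩)
    · have hq : H.color a ≠ H.color q := hp ▸ hadj hpq
      rcases H.turn_trichotomy ct hq with rfl | h1 | h1
      · exact Or.inr rfl
      · exact Or.inl (Or.inr ⟨hq, h1⟩)
      · rcases hp' with rfl | hp'
        · exact (hmin q hpq).symm.imp_left (fun h => Or.inr ⟨hq, h⟩)
        · exact (h.not_crossing_of_turn hpl hp rfl hq ct
            ((h.turn_same_color_pos_iff hp rfl ct hq).1 hp') h1 hpq hat).elim
    · by_cases hq : H.color a = H.color q
      · refine Or.inl (Or.inl ⟨hq, ?_⟩)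
        by_contra! hn
        have hlt : 0 < H.turn a q t := by
          rw [H.turn_swap]
          have := H.turn_ne_zero hn.1 (H.ne_of_color_ne (hq ▸ ct)) (H.ne_of_color_ne ct)
          have := lt_of_le_of_ne hn.2 this
          linarith
        exact h.not_crossing_of_turn hpl rfl hq ct hp hlt htp hat hpq.symm
      · rcases H.turn_trichotomy ct hq with rfl | h1 | h1
        · exact Or.inr rfl
        · exact Or.inl (Or.inr ⟨hq, h1⟩)
        · exact (h.consecutive hC hpl ha hq hp ct hpq.symm htC h1 htp).elim

end IsBase

/-- A non-rainbow plane cycle forces one of the four configurations. -/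
theorem HasNonRainbowPlaneCycle.contains_configuration (h : H.HasNonRainbowPlaneCycle) :
    H.ContainsC1 ∨ H.ContainsC2 ∨ H.ContainsC3 ∨ H.ContainsC4 := by
  obtain ⟨x, C, hC, hpl, a, ha, b, hb, hab, hc⟩ := h
  by_contra! hn
  obtain ⟨n1, n2, n3, n4⟩ := hn
  obtain ⟨t, hat⟩ : ∃ t, C.toSubgraph.Adj a t := by
    obtain ⟨p, q, -, hpq⟩ := Set.ncard_eq_two.1 (hC.ncard_neighborSet_toSubgraph_eq_two ha)
    have : p ∈ C.toSubgraph.neighborSet a := by rw [hpq]; simp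
    exact ⟨p, this⟩
  have ct := (H.adj_iff _ _).1 hat.adj_sub
  have hside (y) (hy : H.color a ≠ H.color y) :=
    H.turn_mul_pos_of_same_color n1 n2 hab hc ct hy
  rcases lt_or_gt_of_ne (H.turn_ne_zero hab (H.ne_of_color_ne ct)
    (H.ne_of_color_ne (hc ▸ ct))) with ht | ht
  · refine IsBase.not_isPlane (a := b) (b := a) ⟨n1, n2, n3, n4, hab.symm, hc.symm, fun y hy => ?_⟩
      hC hpl hb ha
    have := (neg_iff_neg_of_mul_pos (hside y (hc ▸ hy))).1 ht
    rw [H.turn_swap]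
    linarith
  · exact IsBase.not_isPlane ⟨n1, n2, n3, n4, hab, hc,
      fun y hy => (pos_iff_pos_of_mul_pos (hside y hy)).1 ht⟩ hC hpl ha hb

end GeometricCompleteMultipartiteGraph

/-! ### Planarity of closed walks -/

namespace GeometricGraph

variable {V : Type*} (D : GeometricGraph V)

/-- It suffices to test planarity of a walk on pairs of positions in its list of edges. -/
theorem isPlane_toSubgraph {x y : V} {p : D.graph.Walk x y} {l : List (V × V)}
    (hl : p.edges = l.map fun e => s(e.1, e.2))
    (h : l.Pairwise fun e f => Disjoint (openSegment ℝ (D.pos e.1) (D.pos e.2))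
      (openSegment ℝ (D.pos f.1) (D.pos f.2))) :
    D.IsPlane p.toSubgraph := by
  intro a b c d hab hcd hne
  rw [SimpleGraph.Walk.adj_toSubgraph_iff_mem_edges, hl, List.mem_map] at hab hcd
  obtain ⟨e, he, hab⟩ := hab
  obtain ⟨f, hf, hcd⟩ := hcd
  have hef : e ≠ f := by
    rintro rfl
    exact hne (hab.symm.trans hcd)
  have : Std.Symm fun e f : V × V => Disjoint (openSegment ℝ (D.pos e.1) (D.pos e.2))
      (openSegment ℝ (D.pos f.1) (D.pos f.2)) := ⟨fun _ _ h => h.symm⟩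
  have key := h.forall he hf hef
  have seg (e : V × V) {a b : V} (h : s(e.1, e.2) = s(a, b)) :
      openSegment ℝ (D.pos e.1) (D.pos e.2) = openSegment ℝ (D.pos a) (D.pos b) := by
    rcases Sym2.eq_iff.1 h with ⟨h1, h2⟩ | ⟨h1, h2⟩
    · rw [h1, h2]
    · rw [h1, h2, openSegment_symm]
  rwa [seg e hab, seg f hcd] at key

theorem disjoint_of_common_end {u v w : V} (h1 : u ≠ v) (h2 : u ≠ w) (h3 : v ≠ w) :
    Disjoint (openSegment ℝ (D.pos u) (D.pos v)) (openSegment ℝ (D.pos v) (D.pos w)) :=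
  disjoint_openSegment_of_common_end (D.turn_ne_zero h1 h2 h3)

theorem disjoint_of_turn (p q : V) {a b c d : V}
    (ha : 0 ≤ D.turn p q a) (hb : 0 ≤ D.turn p q b)
    (hc : D.turn p q c ≤ 0) (hd : D.turn p q d ≤ 0)
    (h : 0 < D.turn p q a + D.turn p q b ∨ D.turn p q c + D.turn p q d < 0) :
    Disjoint (openSegment ℝ (D.pos a) (D.pos b)) (openSegment ℝ (D.pos c) (D.pos d)) :=
  disjoint_openSegment_of_orient (D.pos p) (D.pos q) ha hb hc hd h

theorem turn_self_left (u v : V) : D.turn u v u = 0 := orient_self_left _ _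

theorem turn_self_right (u v : V) : D.turn u v v = 0 := orient_self_right _ _

end GeometricGraph

/-! ### Plane cycles of length four and five -/

namespace GeometricCompleteMultipartiteGraph

variable {V : Type*} (H : GeometricCompleteMultipartiteGraph V)

/-- The closed walk `u v u' v'` is a non-rainbow cycle, with `v` and `v'` to the left and to the
right of its diagonal `u u'`. -/
def IsFourCycle (u u' v v' : V) : Prop :=
  H.color u ≠ H.color v ∧ H.color u ≠ H.color v' ∧ H.color u' ≠ H.color v ∧
    H.color u' ≠ H.color v' ∧ (H.color u = H.color u' ∨ H.color v = H.color v') ∧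
    0 < H.turn u u' v ∧ 0 < H.turn u' u v'

/-- The closed walk `u w u' v v'` is a cycle with `u` and `u'` of the same color, and the
quadrilateral `u u' v v'` is star-shaped around `w`, counterclockwise. -/
def IsFiveCycle (u u' v v' w : V) : Prop :=
  H.color u = H.color u' ∧ H.color u ≠ H.color v ∧ H.color u ≠ H.color v' ∧
    H.color v ≠ H.color v' ∧ H.color u ≠ H.color w ∧
    0 < H.turn u u' w ∧ 0 < H.turn u' v w ∧ 0 < H.turn v v' w ∧ 0 < H.turn v' u w

variable {H}

theorem IsFourCycle.hasNonRainbowPlaneCycle {u u' v v' : V} (h : H.IsFourCycle u u' v v') :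
    H.HasNonRainbowPlaneCycle := by
  obtain ⟨c1, c2, c3, c4, hc, h1, h2⟩ := h
  obtain ⟨n1, n2, n3⟩ := H.ne_of_turn_ne_zero h1.ne'
  obtain ⟨-, n4, n5⟩ := H.ne_of_turn_ne_zero h2.ne'
  have h2' : H.turn u u' v' < 0 := by rw [H.turn_swap]; linarith
  have n6 : v ≠ v' := by rintro rfl; linarith
  have a1 : H.graph.Adj u v := (H.adj_iff _ _).2 c1
  have a2 : H.graph.Adj v u' := (H.adj_iff _ _).2 c3.symm
  have a3 : H.graph.Adj u' v' := (H.adj_iff _ _).2 c4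
  have a4 : H.graph.Adj v' u := (H.adj_iff _ _).2 c2.symm
  refine ⟨u, .cons a1 (.cons a2 (.cons a3 (.cons a4 .nil))), ?_,
    H.isPlane_toSubgraph (l := [(u, v), (v, u'), (u', v'), (v', u)]) (by simp) ?_, ?_⟩
  · rw [SimpleGraph.Walk.cons_isCycle_iff, SimpleGraph.Walk.isPath_def]
    simp [n1, n2, n4, n5, n6, n1.symm, n2.symm, n3.symm, n5.symm]
  · simp only [List.pairwise_cons, List.mem_cons, List.not_mem_nil, forall_eq_or_imp, or_false,
      forall_eq, IsEmpty.forall_iff, implies_true, List.Pairwise.nil, and_true]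
    -- nonadjacent edges lie on different sides of the diagonal
    refine ⟨⟨?_, ?_, ?_⟩, ⟨?_, ?_⟩, ?_⟩
    · exact H.disjoint_of_common_end n2 n1 n3.symm
    · exact H.disjoint_of_turn u u' (H.turn_self_left _ _).ge h1.le (H.turn_self_right _ _).le
        h2'.le (Or.inr (by rw [H.turn_self_right]; linarith))
    · exact (H.disjoint_of_common_end n5.symm n6.symm n2).symm
    · exact H.disjoint_of_common_end n3.symm n6 n4
    · exact H.disjoint_of_turn u u' h1.le (H.turn_self_right _ _).ge h2'.le
        (H.turn_self_left _ _).le (Or.inr (by rw [H.turn_self_left]; linarith))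
    · exact H.disjoint_of_common_end n4 n1.symm n5.symm
  · rcases hc with hc | hc
    · exact ⟨u, by simp, u', by simp, n1, hc⟩
    · exact ⟨v, by simp, v', by simp, n6, hc⟩

theorem IsFiveCycle.hasNonRainbowPlaneCycle {u u' v v' w : V} (h : H.IsFiveCycle u u' v v' w) :
    H.HasNonRainbowPlaneCycle := by
  obtain ⟨hc, c1, c2, c3, c4, h1, h2, h3, h4⟩ := h
  obtain ⟨n1, n2, n3⟩ := H.ne_of_turn_ne_zero h1.ne'
  obtain ⟨n4, -, n5⟩ := H.ne_of_turn_ne_zero h2.ne'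
  obtain ⟨n6, -, n7⟩ := H.ne_of_turn_ne_zero h3.ne'
  obtain ⟨n8, -, -⟩ := H.ne_of_turn_ne_zero h4.ne'
  have n9 : u ≠ v := H.ne_of_color_ne c1
  have n10 : u' ≠ v' := H.ne_of_color_ne (hc ▸ c2)
  have a1 : H.graph.Adj u w := (H.adj_iff _ _).2 c4
  have a2 : H.graph.Adj w u' := (H.adj_iff _ _).2 (hc ▸ c4.symm)
  have a3 : H.graph.Adj u' v := (H.adj_iff _ _).2 (hc ▸ c1)
  have a4 : H.graph.Adj v v' := (H.adj_iff _ _).2 c3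
  have a5 : H.graph.Adj v' u := (H.adj_iff _ _).2 c2.symm
  -- the four left turns, seen from `w`
  have t1 : 0 < H.turn w u u' := by rwa [← H.turn_rotate]
  have t2 : 0 < H.turn w u' v := by rwa [← H.turn_rotate]
  have t3 : 0 < H.turn w v v' := by rwa [← H.turn_rotate]
  have t4 : 0 < H.turn w v' u := by rwa [← H.turn_rotate]
  have s1 : H.turn w u' u < 0 := by rw [H.turn_swap_right]; linarith
  have s2 : H.turn w v u' < 0 := by rw [H.turn_swap_right]; linarith
  have s3 : H.turn w v' v < 0 := by rw [H.turn_swap_right]; linarith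
  have s4 : H.turn w u v' < 0 := by rw [H.turn_swap_right]; linarith
  refine ⟨u, .cons a1 (.cons a2 (.cons a3 (.cons a4 (.cons a5 .nil)))), ?_,
    H.isPlane_toSubgraph (l := [(u, w), (w, u'), (u', v), (v, v'), (v', u)]) (by simp) ?_,
    ⟨u, by simp, u', by simp, n1, hc⟩⟩
  · rw [SimpleGraph.Walk.cons_isCycle_iff, SimpleGraph.Walk.isPath_def]
    simp [n1, n2, n4, n6, n8, n9, n10, n1.symm, n2.symm, n3.symm, n5.symm,
      n7.symm, n8.symm, n9.symm]
  · simp only [List.pairwise_cons, List.mem_cons, List.not_mem_nil, forall_eq_or_imp, or_false,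
      forall_eq, IsEmpty.forall_iff, implies_true, List.Pairwise.nil, and_true]
    -- nonadjacent edges are separated by the line through `w` and a suitable vertex
    refine ⟨⟨?_, ?_, ?_, ?_⟩, ⟨?_, ?_, ?_⟩, ⟨?_, ?_⟩, ?_⟩
    · exact H.disjoint_of_common_end n2 n1 n3.symm
    · exact (H.disjoint_of_turn w u' t2.le (H.turn_self_right _ _).ge (H.turn_self_left _ _).le
        s1.le (Or.inr (by rw [H.turn_self_left]; linarith))).symm.mono
        (by rw [openSegment_symm]) (by rw [openSegment_symm])
    · rcases le_or_gt (H.turn w u v) 0 with h | h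
      · exact H.disjoint_of_turn w u (H.turn_self_right _ _).ge (H.turn_self_left _ _).ge h s4.le
          (Or.inr (by linarith))
      · have h' : H.turn w v u < 0 := by rw [H.turn_swap_right]; linarith
        exact (H.disjoint_of_turn w v (H.turn_self_right _ _).ge t3.le h'.le
          (H.turn_self_left _ _).le (Or.inr (by rw [H.turn_self_left]; linarith))).symm
    · exact (H.disjoint_of_common_end n8 n7 n2).symm
    · exact H.disjoint_of_common_end n3.symm n5.symm n4
    · rcases le_or_gt 0 (H.turn w u' v') with h | h
      · exact (H.disjoint_of_turn w u' t2.le h (H.turn_self_left _ _).le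
          (H.turn_self_right _ _).le (Or.inl (by linarith))).symm
      · have h' : 0 < H.turn w v' u' := by rw [H.turn_swap_right]; linarith
        exact H.disjoint_of_turn w v' (H.turn_self_left _ _).ge h'.le s3.le
          (H.turn_self_right _ _).le (Or.inr (by rw [H.turn_self_right]; linarith))
    · exact H.disjoint_of_turn w u (H.turn_self_left _ _).ge t1.le s4.le
        (H.turn_self_right _ _).le (Or.inr (by rw [H.turn_self_right]; linarith))
    · exact H.disjoint_of_common_end n4 n10 n6
    · rcases le_or_gt 0 (H.turn w u v) with h | h
      · exact H.disjoint_of_turn w u t1.le h s4.le (H.turn_self_right _ _).le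
          (Or.inl (by linarith))
      · have h' : 0 < H.turn w v u := by rw [H.turn_swap_right]; linarith
        exact (H.disjoint_of_turn w v t3.le h'.le s2.le (H.turn_self_right _ _).le
          (Or.inl (by linarith))).symm
    · exact H.disjoint_of_common_end n6 n9.symm n8

/-! ### From configurations to cycles -/

variable (H)

theorem exists_isFourCycle_of_separates {u u' v v' : V} (hs : H.Separates u u' v v')
    (hu : u ≠ u') (c1 : H.color u ≠ H.color v) (c2 : H.color u ≠ H.color v')
    (c3 : H.color u' ≠ H.color v) (c4 : H.color u' ≠ H.color v')
    (hc : H.color u = H.color u' ∨ H.color v = H.color v') :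
    ∃ u u' v v', H.IsFourCycle u u' v v' := by
  rw [H.separates_iff hu, mul_neg_iff] at hs
  rcases hs with ⟨h1, h2⟩ | ⟨h1, h2⟩
  · exact ⟨u, u', v, v', c1, c2, c3, c4, hc, h1, by rw [H.turn_swap]; linarith⟩
  · exact ⟨u, u', v', v, c2, c1, c4, c3, hc.imp_right Eq.symm, h2, by rw [H.turn_swap]; linarith⟩

/-- If `c` and `d` lie to the left of the side `a b` of a convex quadrilateral, then the line `c d`
does not separate `a` and `b`. -/
theorem _root_.ConvexIndependent.orient_mul_nonneg {a b c d : Plane}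
    (hci : ConvexIndependent ℝ ![a, b, c, d]) (h1 : 0 < orient a b c) (h2 : 0 < orient a b d) :
    0 ≤ orient c d a * orient c d b := by
  rw [convexIndependent_iff_notMem_convexHull_sdiff] at hci
  by_contra! hneg
  have e1 : orient c d a = orient a c d := by simp only [orient]; ring
  have e2 : orient c d b = orient b c d := by simp only [orient]; ring
  have e3 : orient d a c = orient a c d := by simp only [orient]; ring
  rw [e1, e2, mul_neg_iff] at hneg
  rcases hneg with ⟨h3, h4⟩ | ⟨h3, h4⟩
  · refine hci 2 Set.univ (convexHull_mono ?_ (mem_convexHull_triangle h2 (p := c) h1.le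
      (by rw [orient_swap_right]; linarith) (e3 ▸ h3.le)))
    rintro x (rfl | rfl | rfl)
    exacts [⟨0, by simp⟩, ⟨1, by simp⟩, ⟨3, by simp⟩]
  · refine hci 3 Set.univ (convexHull_mono ?_ (mem_convexHull_triangle h1 (p := d) h2.le h4.le
      (by rw [orient_swap]; linarith)))
    rintro x (rfl | rfl | rfl)
    exacts [⟨0, by simp⟩, ⟨1, by simp⟩, ⟨2, by simp⟩]

/-- In a convex quadrilateral with counterclockwise corners, a vertex in the interior sees all four
sides counterclockwise. -/
theorem isFiveCycle_of_turn {u u' v v' w : V} (hn : [u, u', v, v', w].Nodup)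
    (hu : H.color u = H.color u') (hc : [H.color u, H.color v, H.color v', H.color w].Nodup)
    (h1 : 0 < H.turn u u' v) (h2 : 0 < H.turn u u' v') (h3 : 0 < H.turn v v' u)
    (h4 : 0 < H.turn v v' u')
    (hw : H.pos w ∈ interior (convexHull ℝ {H.pos u, H.pos u', H.pos v, H.pos v'})) :
    H.IsFiveCycle u u' v v' w := by
  simp only [List.nodup_cons, List.mem_cons, List.not_mem_nil, or_false, not_or, not_false_eq_true,
    List.nodup_nil, and_true] at hn hc
  obtain ⟨⟨n1, n2, n3, n4⟩, ⟨n5, n6, n7⟩, ⟨n8, n9⟩, n10⟩ := hn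
  obtain ⟨⟨c1, c2, c3⟩, ⟨c4, c5⟩, c6⟩ := hc
  have key {p q : V} (hpq : p ≠ q) (hp : p ≠ w) (hq : q ≠ w)
      (hs : 0 ≤ H.turn p q u ∧ 0 ≤ H.turn p q u' ∧ 0 ≤ H.turn p q v ∧ 0 ≤ H.turn p q v') :
      0 < H.turn p q w := by
    refine lt_of_le_of_ne (orient_nonneg_of_mem_convexHull ?_ (interior_subset hw))
      (H.turn_ne_zero hpq hp hq).symm
    rintro x (rfl | rfl | rfl | rfl)
    exacts [hs.1, hs.2.1, hs.2.2.1, hs.2.2.2]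
  have e1 : H.turn u' v u = H.turn u u' v := H.turn_rotate _ _ _
  have e2 : H.turn u' v v' = H.turn v v' u' := (H.turn_rotate _ _ _).symm
  have e3 : H.turn v' u u' = H.turn u u' v' := (H.turn_rotate _ _ _).symm
  have e4 : H.turn v' u v = H.turn v v' u := H.turn_rotate _ _ _
  refine ⟨hu, c1, c2, c4, c3, key n1 n4 n7 ?_, key n5 n7 n9 ?_, key n8 n9 n10 ?_,
    key (Ne.symm n3) n10 n4 ?_⟩
  · simp [H.turn_self_left, H.turn_self_right, h1.le, h2.le]
  · simp [H.turn_self_left, H.turn_self_right, e1, e2, h1.le, h4.le]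
  · simp [H.turn_self_left, H.turn_self_right, h3.le, h4.le]
  · simp [H.turn_self_left, H.turn_self_right, e3, e4, h2.le, h3.le]

/-- In a configuration `C₄` whose two vertices of the same color span a side of the quadrilateral,
that side can be replaced by a path through the interior vertex. -/
theorem exists_isFiveCycle {u u' v v' w : V} (hn : [u, u', v, v', w].Nodup)
    (hu : H.color u = H.color u') (hc : [H.color u, H.color v, H.color v', H.color w].Nodup)
    (hci : ConvexIndependent ℝ ![H.pos u, H.pos u', H.pos v, H.pos v'])
    (hw : H.pos w ∈ interior (convexHull ℝ {H.pos u, H.pos u', H.pos v, H.pos v'}))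
    (h1 : 0 < H.turn u u' v) (h2 : 0 < H.turn u u' v') :
    ∃ u u' v v' w, H.IsFiveCycle u u' v v' w := by
  obtain ⟨-, n1, n2⟩ := H.ne_of_turn_ne_zero h1.ne'
  obtain ⟨-, n3, n4⟩ := H.ne_of_turn_ne_zero h2.ne'
  have n5 : v ≠ v' := by rintro rfl; simp at hn
  have e1 := H.turn_ne_zero n5 n1.symm n3.symm
  have e2 := H.turn_ne_zero n5 n2.symm n4.symm
  have hm : 0 < H.turn v v' u * H.turn v v' u' :=
    lt_of_le_of_ne (hci.orient_mul_nonneg h1 h2) (mul_ne_zero e1 e2).symm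
  rcases mul_pos_iff.1 hm with ⟨h3, h4⟩ | ⟨h3, h4⟩
  · exact ⟨u, u', v, v', w, H.isFiveCycle_of_turn hn hu hc h1 h2 h3 h4 hw⟩
  · refine ⟨u, u', v', v, w, H.isFiveCycle_of_turn
      ((List.Perm.nodup_iff (((List.Perm.swap v v' [w]).cons u').cons u)).2 hn) hu
      ((List.Perm.nodup_iff ((List.Perm.swap (H.color v) (H.color v') _).cons _)).2 hc) h2 h1
      ?_ ?_ ?_⟩
    · rw [H.turn_swap]; linarith
    · rw [H.turn_swap]; linarith
    · rwa [Set.pair_comm (H.pos v')]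

/-- Each of the four configurations contains a plane cycle of length four or five. -/
theorem exists_cycle_of_configuration
    (h : H.ContainsC1 ∨ H.ContainsC2 ∨ H.ContainsC3 ∨ H.ContainsC4) :
    (∃ u u' v v', H.IsFourCycle u u' v v') ∨ ∃ u u' v v' w, H.IsFiveCycle u u' v v' w := by
  rcases h with ⟨u, u', v, v', hn, hu, hv, hc, hs⟩ | ⟨u, u', v, v', hn, hu, hc, hs⟩ |
    ⟨u, u', v, v', hn, hv, hc, hs⟩ | ⟨u, u', v, v', w, hn, hu, hc, hci, hw⟩
  · have hne : u ≠ u' := by rintro rfl; simp at hn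
    exact Or.inl (H.exists_isFourCycle_of_separates hs hne hc (hv ▸ hc) (hu ▸ hc)
      (hu ▸ hv ▸ hc) (Or.inl hu))
  · have hne : u ≠ u' := by rintro rfl; simp at hn
    simp only [List.nodup_cons, List.mem_cons, List.not_mem_nil, or_false, not_or] at hc
    exact Or.inl (H.exists_isFourCycle_of_separates hs hne hc.1.1 hc.1.2 (hu ▸ hc.1.1)
      (hu ▸ hc.1.2) (Or.inl hu))
  · have hne : u ≠ u' := by rintro rfl; simp at hn
    simp only [List.nodup_cons, List.mem_cons, List.not_mem_nil, or_false, not_or] at hc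
    exact Or.inl (H.exists_isFourCycle_of_separates hs hne hc.1.2 (hv ▸ hc.1.2) hc.2.1
      (hv ▸ hc.2.1) (Or.inr hv))
  · by_cases hs : H.turn u u' v * H.turn u u' v' < 0
    · have hne : u ≠ u' := by rintro rfl; simp at hn
      simp only [List.nodup_cons, List.mem_cons, List.not_mem_nil, or_false, not_or] at hc
      exact Or.inl (H.exists_isFourCycle_of_separates ((H.separates_iff hne v v').2 hs) hne
        hc.1.1 hc.1.2.1 (hu ▸ hc.1.1) (hu ▸ hc.1.2.1) (Or.inl hu))
    right
    have m1 := H.turn_ne_zero (u := u) (v := u') (w := v) (by rintro rfl; simp at hn)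
      (by rintro rfl; simp at hn) (by rintro rfl; simp at hn)
    have m2 := H.turn_ne_zero (u := u) (v := u') (w := v') (by rintro rfl; simp at hn)
      (by rintro rfl; simp at hn) (by rintro rfl; simp at hn)
    rcases mul_pos_iff.1 (lt_of_le_of_ne (not_lt.1 hs) (mul_ne_zero m1 m2).symm) with
      ⟨h1, h2⟩ | ⟨h1, h2⟩
    · exact H.exists_isFiveCycle hn hu hc hci hw h1 h2
    · refine H.exists_isFiveCycle (u := u') (u' := u)
        ((List.Perm.nodup_iff (List.Perm.swap u u' _)).2 hn) hu.symm (hu ▸ hc) ?_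
        (by rwa [Set.insert_comm]) (by rw [H.turn_swap]; linarith) (by rw [H.turn_swap]; linarith)
      convert hci.comp_embedding (Equiv.swap (0 : Fin 4) 1).toEmbedding using 1
      ext i
      fin_cases i <;> rfl

theorem hasNonRainbowPlaneCycle_iff_exists_cycle : H.HasNonRainbowPlaneCycle ↔
    (∃ u u' v v', H.IsFourCycle u u' v v') ∨ ∃ u u' v v' w, H.IsFiveCycle u u' v v' w := by
  refine ⟨fun h => H.exists_cycle_of_configuration h.contains_configuration, ?_⟩
  rintro (⟨u, u', v, v', h⟩ | ⟨u, u', v, v', w, h⟩)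
  exacts [h.hasNonRainbowPlaneCycle, h.hasNonRainbowPlaneCycle]

theorem hasNonRainbowPlaneCycle_iff : H.HasNonRainbowPlaneCycle ↔
    (H.ContainsC1 ∨ H.ContainsC2 ∨ H.ContainsC3 ∨ H.ContainsC4) :=
  ⟨fun h => h.contains_configuration,
    fun h => H.hasNonRainbowPlaneCycle_iff_exists_cycle.2 (H.exists_cycle_of_configuration h)⟩

end GeometricCompleteMultipartiteGraph

/-! ### Running programs of the real RAM -/

namespace RealRAM

/-- The program part `P`, started on the store `s`, is completed within `t` steps and leaves the
store `s'`, whatever remains to be executed afterwards. -/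
def Runs (P : Prog) (t : ℕ) (s s' : Store) : Prop :=
  ∃ τ ≤ t, ∀ k, step^[τ] (P :: k, s) = (k, s')

namespace Runs

variable {P Q : Prog} {c : Test} {t t' : ℕ} {s s₁ s' : Store}

theorem mono (h : Runs P t s s') (ht : t ≤ t') : Runs P t' s s' :=
  let ⟨τ, hτ, h⟩ := h
  ⟨τ, hτ.trans ht, h⟩

theorem op (o : Op) (s : Store) : Runs (.op o) 1 s (o.exec s) :=
  ⟨1, le_rfl, fun _ => rfl⟩

theorem seq (h : Runs P t s s₁) (h' : Runs Q t' s₁ s') : Runs (.seq P Q) (t + t' + 1) s s' := by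
  obtain ⟨τ, hτ, h⟩ := h
  obtain ⟨τ', hτ', h'⟩ := h'
  refine ⟨τ' + τ + 1, by omega, fun k => ?_⟩
  rw [Function.iterate_succ_apply, Function.iterate_add_apply, step, h, h']

theorem ite_pos (hc : c.holds s) (h : Runs P t s s') : Runs (.ite c P Q) (t + 1) s s' := by
  obtain ⟨τ, hτ, h⟩ := h
  refine ⟨τ + 1, by omega, fun k => ?_⟩
  rw [Function.iterate_succ_apply, step, if_pos hc, h]

theorem ite_neg (hc : ¬ c.holds s) (h : Runs Q t s s') : Runs (.ite c P Q) (t + 1) s s' := by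
  obtain ⟨τ, hτ, h⟩ := h
  refine ⟨τ + 1, by omega, fun k => ?_⟩
  rw [Function.iterate_succ_apply, step, if_neg hc, h]

theorem while_neg (hc : ¬ c.holds s) : Runs (.while c P) 1 s s := by
  refine ⟨1, le_rfl, fun k => ?_⟩
  rw [Function.iterate_one, step, if_neg hc]

theorem while_pos (hc : c.holds s) (h : Runs P t s s₁) (h' : Runs (.while c P) t' s₁ s') :
    Runs (.while c P) (t + t' + 1) s s' := by
  obtain ⟨τ, hτ, h⟩ := h
  obtain ⟨τ', hτ', h'⟩ := h'
  refine ⟨τ' + τ + 1, by omega, fun k => ?_⟩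
  rw [Function.iterate_succ_apply, Function.iterate_add_apply, step, if_pos hc, h, h']

theorem haltsWithin (h : Runs P t s s') : HaltsWithin P s t s' := by
  obtain ⟨τ, hτ, h⟩ := h
  obtain ⟨d, rfl⟩ := Nat.exists_eq_add_of_le hτ
  have hd : ∀ d, step^[d] ([], s') = ([], s') := fun d => Function.iterate_fixed rfl d
  rw [HaltsWithin, add_comm, Function.iterate_add_apply, h, hd]

end Runs

/-- A list of instructions, followed by `P`. -/
def block (l : List Op) (P : Prog) : Prog := l.foldr (fun o Q => .seq (.op o) Q) P

theorem Runs.block {P : Prog} {t : ℕ} {l : List Op} {s s' : Store}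
    (h : Runs P t (l.foldl Op.exec s) s') : Runs (block l P) (t + 2 * l.length) s s' := by
  induction l generalizing s with
  | nil => exact h
  | cons o l ih => exact ((Runs.op o s).seq (ih h)).mono (by simp only [List.length_cons]; omega)

/-! ### Specifications of programs -/

/-- The arrays hold `c` and `x`, and the natural number registers `1, ..., m - 1` hold the values
prescribed by `ρ`. -/
def Store.Agrees (c : ℕ → ℕ) (x : ℕ → ℝ) (m : ℕ) (ρ : ℕ → ℕ) (s : Store) : Prop :=
  (∀ r, 0 < r → r < m → s.N r = ρ r) ∧ s.natMem = c ∧ s.realMem = x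

/-- On stores that agree with `ρ` below `m`, the program `P` preserves this agreement, and within
time `t` it sets the answer register `0` to `1` if `φ` holds and keeps a positive answer. -/
def Flags (c : ℕ → ℕ) (x : ℕ → ℝ) (m : ℕ) (P : Prog) (t : ℕ) (ρ : ℕ → ℕ) (φ : Prop) : Prop :=
  ∀ s : Store, s.Agrees c x m ρ →
    ∃ s', Runs P t s s' ∧ s'.Agrees c x m ρ ∧ (s'.N 0 = 1 ↔ s.N 0 = 1 ∨ φ)

/-- Give a positive answer. -/
def accept : Prog := .op (.natConst 0 1)

/-- The instruction without effect. -/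
def skip : Prog := .op (.natCopy 0 0)

/-- Run `P` with the register `i` ranging over `0, ..., n - 1`, where register `1` holds `n` and
register `2` holds `1`. -/
def forLoop (i : ℕ) (P : Prog) : Prog :=
  .seq (.op (.natConst i 0)) (.while (.natLt i 1) (.seq P (.op (.natAdd i i 2))))

/-- Run `P` if the vertices with numbers in registers `i` and `j` have the same color. -/
def ifSameColor (i j : ℕ) (P : Prog) : Prog :=
  block [.natLoad 8 i, .natLoad 9 j] (.ite (.natEq 8 9) P skip)

/-- Run `P` if the vertices with numbers in registers `i` and `j` have different colors. -/
def ifDiffColor (i j : ℕ) (P : Prog) : Prog :=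
  block [.natLoad 8 i, .natLoad 9 j] (.ite (.natEq 8 9) skip P)

/-- Run `P` if the vertices with numbers in registers `i`, `j`, `k` form a left turn. -/
def ifLeftTurn (i j k : ℕ) (P : Prog) : Prog :=
  block [.natAdd 8 i i, .realLoad 0 8, .natAdd 8 8 2, .realLoad 1 8,
    .natAdd 8 j j, .realLoad 2 8, .natAdd 8 8 2, .realLoad 3 8,
    .natAdd 8 k k, .realLoad 4 8, .natAdd 8 8 2, .realLoad 5 8,
    .realSub 2 2 0, .realSub 3 3 1, .realSub 4 4 0, .realSub 5 5 1,
    .realMul 2 2 5, .realMul 3 3 4, .realConst 0 0, .realSub 1 2 3]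
    (.ite (.realLt 0 1) P skip)

/-- The orientation of three points whose coordinates are stored in the array `x`. -/
def orientAt (x : ℕ → ℝ) (i j k : ℕ) : ℝ :=
  (x (j + j) - x (i + i)) * (x (k + k + 1) - x (i + i + 1)) -
    (x (j + j + 1) - x (i + i + 1)) * (x (k + k) - x (i + i))

namespace Flags

variable {c : ℕ → ℕ} {x : ℕ → ℝ} {m : ℕ} {P Q : Prog} {t t' : ℕ} {ρ : ℕ → ℕ} {φ ψ : Prop}

theorem mono (h : Flags c x m P t ρ φ) (ht : t ≤ t') : Flags c x m P t' ρ φ := fun s hs =>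
  let ⟨s', h1, h2⟩ := h s hs
  ⟨s', h1.mono ht, h2⟩

theorem accept : Flags c x m accept 1 ρ True := by
  intro s hs
  refine ⟨_, Runs.op _ s, ⟨fun r h0 hr => ?_, hs.2⟩, by simp [Op.exec]⟩
  simp only [Op.exec]
  rw [Function.update_of_ne h0.ne', hs.1 r h0 hr]

theorem skip : Flags c x m skip 1 ρ False := by
  intro s hs
  refine ⟨_, Runs.op _ s, ⟨fun r h0 hr => ?_, hs.2⟩, by simp [Op.exec]⟩
  simp only [Op.exec]
  rw [Function.update_of_ne h0.ne', hs.1 r h0 hr]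

theorem seq (h : Flags c x m P t ρ φ) (h' : Flags c x m Q t' ρ ψ) :
    Flags c x m (.seq P Q) (t + t' + 1) ρ (φ ∨ ψ) := by
  intro s hs
  obtain ⟨s₁, r1, a1, e1⟩ := h s hs
  obtain ⟨s₂, r2, a2, e2⟩ := h' s₁ a1
  exact ⟨s₂, r1.seq r2, a2, by rw [e2, e1, or_assoc]⟩

/-- A test after instructions that change auxiliary registers only. -/
theorem block_ite {l : List Op} {T : Test} (h : Flags c x m P t ρ φ) (ht : 1 ≤ t)
    (hl : ∀ s : Store, s.Agrees c x m ρ → (l.foldl Op.exec s).Agrees c x m ρ ∧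
      (l.foldl Op.exec s).N 0 = s.N 0 ∧ (T.holds (l.foldl Op.exec s) ↔ ψ)) :
    Flags c x m (block l (.ite T P RealRAM.skip)) (t + 1 + 2 * l.length) ρ (ψ ∧ φ) := by
  intro s hs
  obtain ⟨ha, h0, hT⟩ := hl s hs
  by_cases hψ : ψ
  · obtain ⟨s', h1, h2, h3⟩ := h _ ha
    exact ⟨s', (Runs.ite_pos (hT.2 hψ) h1).block, h2, by rw [h3, h0]; simp [hψ]⟩
  · obtain ⟨s', h1, h2, h3⟩ := (skip.mono ht) _ ha
    exact ⟨s', (Runs.ite_neg (fun h => hψ (hT.1 h)) h1).block, h2, by rw [h3, h0]; simp [hψ]⟩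

theorem block_ite_not {l : List Op} {T : Test} (h : Flags c x m P t ρ φ) (ht : 1 ≤ t)
    (hl : ∀ s : Store, s.Agrees c x m ρ → (l.foldl Op.exec s).Agrees c x m ρ ∧
      (l.foldl Op.exec s).N 0 = s.N 0 ∧ (T.holds (l.foldl Op.exec s) ↔ ψ)) :
    Flags c x m (block l (.ite T RealRAM.skip P)) (t + 1 + 2 * l.length) ρ (¬ ψ ∧ φ) := by
  intro s hs
  obtain ⟨ha, h0, hT⟩ := hl s hs
  by_cases hψ : ψ
  · obtain ⟨s', h1, h2, h3⟩ := (skip.mono ht) _ ha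
    exact ⟨s', (Runs.ite_pos (hT.2 hψ) h1).block, h2, by rw [h3, h0]; simp [hψ]⟩
  · obtain ⟨s', h1, h2, h3⟩ := h _ ha
    exact ⟨s', (Runs.ite_neg (fun h => hψ (hT.1 h)) h1).block, h2, by rw [h3, h0]; simp [hψ]⟩

theorem forLoop {i n : ℕ} {φ : ℕ → Prop} (hi : 2 < i) (h1 : ρ 1 = n) (h2 : ρ 2 = 1)
    (h : ∀ j < n, Flags c x (i + 1) P t (Function.update ρ i j) (φ j)) :
    Flags c x i (forLoop i P) ((n + 1) * (t + 3)) ρ (∃ j < n, φ j) := by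
  have key : ∀ d j (s : Store), j + d = n → s.Agrees c x i ρ → s.N i = j →
      ∃ s', Runs (.while (.natLt i 1) (.seq P (.op (.natAdd i i 2)))) (d * (t + 3) + 1) s s' ∧
        s'.Agrees c x i ρ ∧ (s'.N 0 = 1 ↔ s.N 0 = 1 ∨ ∃ k, j ≤ k ∧ k < n ∧ φ k) := by
    intro d
    induction d with
    | zero =>
      intro j s hj hs hsj
      refine ⟨s, (Runs.while_neg ?_).mono (by omega), hs, ?_⟩
      · rw [Test.holds, hs.1 1 (by omega) (by omega)]; omega
      · exact ⟨Or.inl, fun h => h.resolve_right fun ⟨k, h1, h2, _⟩ => by omega⟩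
    | succ d ih =>
      intro j s hj hs hsj
      obtain ⟨s₁, r1, a1, e1⟩ := h j (by omega) s ⟨fun r h0 hr => by
        rcases Nat.lt_succ_iff_lt_or_eq.1 hr with hr | rfl
        · rw [Function.update_of_ne hr.ne, hs.1 r h0 hr]
        · rw [Function.update_self, hsj], hs.2⟩
      have a1' : s₁.Agrees c x i ρ := ⟨fun r h0 hr => by
        rw [a1.1 r h0 (by omega), Function.update_of_ne hr.ne], a1.2⟩
      obtain ⟨s₂, r2, a2, e2⟩ := ih (j + 1) ((Op.natAdd i i 2).exec s₁) (by omega)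
        ⟨fun r h0 hr => by
          simp only [Op.exec]
          rw [Function.update_of_ne hr.ne, a1'.1 r h0 hr], a1.2⟩
        (by
          simp only [Op.exec, Function.update_self]
          rw [a1.1 i (by omega) (by omega), Function.update_self, a1'.1 2 (by omega) (by omega),
            h2])
      refine ⟨s₂, (Runs.while_pos ?_ (r1.seq (Runs.op _ _)) r2).mono (by ring_nf; omega), a2, ?_⟩
      · rw [Test.holds, hs.1 1 (by omega) (by omega)]; omega
      · have e3 : ((Op.natAdd i i 2).exec s₁).N 0 = s₁.N 0 := by
          simp only [Op.exec]
          rw [Function.update_of_ne (by omega)]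
        rw [e2, e3, e1, or_assoc, or_congr_right]
        constructor
        · rintro (hφ | ⟨k, h1, h2, h3⟩)
          · exact ⟨j, le_rfl, by omega, hφ⟩
          · exact ⟨k, by omega, h2, h3⟩
        · rintro ⟨k, h1, h2, h3⟩
          rcases h1.eq_or_lt with rfl | h1
          · exact Or.inl h3
          · exact Or.inr ⟨k, h1, h2, h3⟩
  intro s hs
  obtain ⟨s', r, a, e⟩ := key n 0 ((Op.natConst i 0).exec s) (by omega)
    ⟨fun r h0 hr => by
      simp only [Op.exec]
      rw [Function.update_of_ne hr.ne, hs.1 r h0 hr], hs.2⟩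
    (by simp [Op.exec])
  refine ⟨s', ((Runs.op _ _).seq r).mono (by ring_nf; omega), a, ?_⟩
  have e3 : ((Op.natConst i 0).exec s).N 0 = s.N 0 := by
    simp only [Op.exec]
    rw [Function.update_of_ne (by omega)]
  rw [e, e3]
  simp

theorem loadColors {i j : ℕ} (hi : 0 < i) (hi' : i < 8) (hj : 0 < j) (hj' : j < 8) {s : Store}
    (hs : s.Agrees c x 8 ρ) :
    ([.natLoad 8 i, .natLoad 9 j].foldl Op.exec s).Agrees c x 8 ρ ∧
      ([.natLoad 8 i, .natLoad 9 j].foldl Op.exec s).N 0 = s.N 0 ∧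
      ((Test.natEq 8 9).holds ([.natLoad 8 i, .natLoad 9 j].foldl Op.exec s) ↔
        c (ρ i) = c (ρ j)) := by
  obtain ⟨h1, h2, h3⟩ := hs
  refine ⟨⟨fun r h0 hr => ?_, h2, h3⟩, ?_, ?_⟩
  · simp [Op.exec, show r ≠ 8 by omega, show r ≠ 9 by omega, h1 r h0 hr]
  · simp [Op.exec]
  · simp [Op.exec, Test.holds, show j ≠ 8 by omega, h1 i hi hi', h1 j hj hj', h2]

theorem ifSameColor (h : Flags c x 8 P t ρ φ) (i j : ℕ) (hi : 0 < i := by norm_num)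
    (hi' : i < 8 := by norm_num) (hj : 0 < j := by norm_num) (hj' : j < 8 := by norm_num)
    (ht : 1 ≤ t := by norm_num) :
    Flags c x 8 (ifSameColor i j P) (t + 5) ρ (c (ρ i) = c (ρ j) ∧ φ) :=
  h.block_ite ht fun _ hs => loadColors hi hi' hj hj' hs

theorem ifDiffColor (h : Flags c x 8 P t ρ φ) (i j : ℕ) (hi : 0 < i := by norm_num)
    (hi' : i < 8 := by norm_num) (hj : 0 < j := by norm_num) (hj' : j < 8 := by norm_num)
    (ht : 1 ≤ t := by norm_num) :
    Flags c x 8 (ifDiffColor i j P) (t + 5) ρ (c (ρ i) ≠ c (ρ j) ∧ φ) :=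
  h.block_ite_not ht fun _ hs => loadColors hi hi' hj hj' hs

theorem ifLeftTurn (h : Flags c x 8 P t ρ φ) (hρ : ρ 2 = 1) (i j k : ℕ)
    (hi : 0 < i := by norm_num) (hi' : i < 8 := by norm_num) (hj : 0 < j := by norm_num)
    (hj' : j < 8 := by norm_num) (hk : 0 < k := by norm_num) (hk' : k < 8 := by norm_num)
    (ht : 1 ≤ t := by norm_num) :
    Flags c x 8 (ifLeftTurn i j k P) (t + 41) ρ (0 < orientAt x (ρ i) (ρ j) (ρ k) ∧ φ) := by
  refine h.block_ite ht fun s hs => ?_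
  obtain ⟨h1, h2, h3⟩ := hs
  refine ⟨⟨fun r h0 hr => ?_, h2, h3⟩, ?_, ?_⟩
  · simp [Op.exec, show r ≠ 8 by omega, h1 r h0 hr]
  · simp [Op.exec]
  · simp [Op.exec, Test.holds, orientAt, show j ≠ 8 by omega,
      show k ≠ 8 by omega, h1 i hi hi', h1 j hj hj', h1 k hk hk', h1 2 (by omega) (by omega), hρ,
      h3]

end Flags

/-! ### The decision program -/

/-- The test for a four-cycle on the vertices with numbers in the registers `3`, `4`, `5`, `6`. -/
def fourCycleTest : Prog :=
  ifDiffColor 3 5 (ifDiffColor 3 6 (ifDiffColor 4 5 (ifDiffColor 4 6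
    (.seq (ifSameColor 3 4 (ifLeftTurn 3 4 5 (ifLeftTurn 4 3 6 accept)))
      (ifSameColor 5 6 (ifLeftTurn 3 4 5 (ifLeftTurn 4 3 6 accept)))))))

/-- The test for a five-cycle on the vertices with numbers in the registers `3`, ..., `7`. -/
def fiveCycleTest : Prog :=
  ifSameColor 3 4 (ifDiffColor 3 5 (ifDiffColor 3 6 (ifDiffColor 5 6 (ifDiffColor 3 7
    (ifLeftTurn 3 4 7 (ifLeftTurn 4 5 7 (ifLeftTurn 5 6 7 (ifLeftTurn 6 3 7 accept))))))))

/-- The decision program: it initializes the registers and tests all quintuples of vertices. -/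
def nonRainbowPlaneCycleProg : Prog :=
  block [.natCopy 1 0, .natConst 2 1, .natConst 0 0]
    (forLoop 3 (forLoop 4 (forLoop 5 (forLoop 6 (forLoop 7 (.seq fourCycleTest fiveCycleTest))))))

/-- The condition tested by `fourCycleTest`. -/
def FourCycleAt (c : ℕ → ℕ) (x : ℕ → ℝ) (i j k l : ℕ) : Prop :=
  c i ≠ c k ∧ c i ≠ c l ∧ c j ≠ c k ∧ c j ≠ c l ∧ (c i = c j ∨ c k = c l) ∧
    0 < orientAt x i j k ∧ 0 < orientAt x j i l

/-- The condition tested by `fiveCycleTest`. -/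
def FiveCycleAt (c : ℕ → ℕ) (x : ℕ → ℝ) (i j k l m : ℕ) : Prop :=
  c i = c j ∧ c i ≠ c k ∧ c i ≠ c l ∧ c k ≠ c l ∧ c i ≠ c m ∧
    0 < orientAt x i j m ∧ 0 < orientAt x j k m ∧ 0 < orientAt x k l m ∧ 0 < orientAt x l i m

section

variable {c : ℕ → ℕ} {x : ℕ → ℝ} {ρ : ℕ → ℕ}

theorem flags_fourCycleTest (hρ : ρ 2 = 1) :
    Flags c x 8 fourCycleTest 200 ρ (FourCycleAt c x (ρ 3) (ρ 4) (ρ 5) (ρ 6)) := by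
  have h1 := (Flags.accept (c := c) (x := x) (m := 8).ifLeftTurn hρ 4 3 6).ifLeftTurn hρ 3 4 5
  have h2 := (((((h1.ifSameColor 3 4).seq (h1.ifSameColor 5 6)).ifDiffColor 4 6).ifDiffColor
    4 5).ifDiffColor 3 6).ifDiffColor 3 5
  rw [← or_and_right, and_true] at h2
  exact h2.mono (by norm_num)

theorem flags_fiveCycleTest (hρ : ρ 2 = 1) :
    Flags c x 8 fiveCycleTest 200 ρ (FiveCycleAt c x (ρ 3) (ρ 4) (ρ 5) (ρ 6) (ρ 7)) := by
  have h := ((((((((Flags.accept (c := c) (x := x) (m := 8).ifLeftTurn hρ 6 3 7).ifLeftTurn hρ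
    5 6 7).ifLeftTurn hρ 4 5 7).ifLeftTurn hρ 3 4 7).ifDiffColor 3 7).ifDiffColor 5 6).ifDiffColor
    3 6).ifDiffColor 3 5).ifSameColor 3 4
  rw [and_true] at h
  exact h.mono (by norm_num)

/-- The five nested loops test all quintuples of vertices. The body takes at most `401` steps, and
each loop adds at most `3` to the leading constant. -/
theorem flags_loops {n : ℕ} (h1 : ρ 1 = n) (h2 : ρ 2 = 1) :
    Flags c x 3
      (forLoop 3 (forLoop 4 (forLoop 5 (forLoop 6 (forLoop 7
        (.seq fourCycleTest fiveCycleTest))))))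
      (416 * (n + 1) ^ 5) ρ
      (∃ i < n, ∃ j < n, ∃ k < n, ∃ l < n, ∃ m < n,
        FourCycleAt c x i j k l ∨ FiveCycleAt c x i j k l m) := by
  -- the overhead of a loop over a body of `a * (n + 1) ^ d` steps
  have time (a d : ℕ) : (n + 1) * (a * (n + 1) ^ d + 3) ≤ (a + 3) * (n + 1) ^ (d + 1) := by
    have := Nat.one_le_pow d (n + 1) (by omega)
    calc (n + 1) * (a * (n + 1) ^ d + 3)
        ≤ (n + 1) * (a * (n + 1) ^ d + 3 * (n + 1) ^ d) := by gcongr; omega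
      _ = (a + 3) * (n + 1) ^ (d + 1) := by ring
  refine (Flags.forLoop (t := 413 * (n + 1) ^ 4) (by norm_num) h1 h2 fun i hi => ?_).mono
    (time 413 4)
  refine (Flags.forLoop (t := 410 * (n + 1) ^ 3) (by norm_num) (by simpa) (by simpa)
    fun j hj => ?_).mono (time 410 3)
  refine (Flags.forLoop (t := 407 * (n + 1) ^ 2) (by norm_num) (by simpa) (by simpa)
    fun k hk => ?_).mono (time 407 2)
  refine (Flags.forLoop (t := 404 * (n + 1) ^ 1) (by norm_num) (by simpa) (by simpa)
    fun l hl => ?_).mono (time 404 1)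
  refine (Flags.forLoop (t := 401 * (n + 1) ^ 0) (by norm_num) (by simpa) (by simpa)
    fun m hm => ?_).mono (time 401 0)
  have h := Flags.seq (flags_fourCycleTest (c := c) (x := x) (ρ := Function.update (Function.update
    (Function.update (Function.update (Function.update ρ 3 i) 4 j) 5 k) 6 l) 7 m) (by simpa))
    (flags_fiveCycleTest (by simpa))
  simpa using h

end

end RealRAM

namespace GeometricCompleteMultipartiteGraph

open RealRAM

variable {V : Type*} {n : ℕ} (H : GeometricCompleteMultipartiteGraph V) (e : Fin n ≃ V)

theorem input_natMem (i : Fin n) : (H.input e).natMem i = H.color (e i) := by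
  simp [input]

theorem orientAt_input (i j k : Fin n) :
    orientAt (H.input e).realMem i j k = H.turn (e i) (e j) (e k) := by
  have h0 (i : Fin n) : (H.input e).realMem (i + i) = H.pos (e i) 0 := by
    simp [input, ← two_mul]
  have h1 (i : Fin n) : (H.input e).realMem (i + i + 1) = H.pos (e i) 1 := by
    have h2 : ((i : ℕ) + i + 1) / 2 = i := by omega
    have h3 : ((i : ℕ) + i + 1) % 2 = 1 := by omega
    simp [input, h2, h3]
  simp only [orientAt, h0, h1, GeometricGraph.turn, orient]

theorem fourCycleAt_input (i j k l : Fin n) :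
    FourCycleAt (H.input e).natMem (H.input e).realMem i j k l ↔
      H.IsFourCycle (e i) (e j) (e k) (e l) := by
  simp only [FourCycleAt, IsFourCycle, input_natMem, orientAt_input]

theorem fiveCycleAt_input (i j k l m : Fin n) :
    FiveCycleAt (H.input e).natMem (H.input e).realMem i j k l m ↔
      H.IsFiveCycle (e i) (e j) (e k) (e l) (e m) := by
  simp only [FiveCycleAt, IsFiveCycle, input_natMem, orientAt_input]

theorem exists_cycleAt_input_iff :
    (∃ i < n, ∃ j < n, ∃ k < n, ∃ l < n, ∃ m < n,
      FourCycleAt (H.input e).natMem (H.input e).realMem i j k l ∨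
      FiveCycleAt (H.input e).natMem (H.input e).realMem i j k l m) ↔
    H.HasNonRainbowPlaneCycle := by
  rw [hasNonRainbowPlaneCycle_iff_exists_cycle]
  constructor
  · rintro ⟨i, hi, j, hj, k, hk, l, hl, m, hm, h | h⟩
    · exact Or.inl ⟨_, _, _, _, (H.fourCycleAt_input e ⟨i, hi⟩ ⟨j, hj⟩ ⟨k, hk⟩ ⟨l, hl⟩).1 h⟩
    · exact Or.inr ⟨_, _, _, _, _,
        (H.fiveCycleAt_input e ⟨i, hi⟩ ⟨j, hj⟩ ⟨k, hk⟩ ⟨l, hl⟩ ⟨m, hm⟩).1 h⟩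
  · rintro (⟨u, u', v, v', h⟩ | ⟨u, u', v, v', w, h⟩)
    · -- the innermost loop variable is irrelevant for a four-cycle
      refine ⟨e.symm u, Fin.is_lt _, e.symm u', Fin.is_lt _, e.symm v, Fin.is_lt _, e.symm v',
        Fin.is_lt _, e.symm u, Fin.is_lt _, Or.inl ?_⟩
      rw [fourCycleAt_input]
      simpa using h
    · refine ⟨e.symm u, Fin.is_lt _, e.symm u', Fin.is_lt _, e.symm v, Fin.is_lt _, e.symm v',
        Fin.is_lt _, e.symm w, Fin.is_lt _, Or.inr ?_⟩
      rw [fiveCycleAt_input]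
      simpa using h

theorem exists_haltsWithin_input :
    ∃ s' : Store, HaltsWithin nonRainbowPlaneCycleProg (H.input e) (416 * (n + 1) ^ 5 + 6) s' ∧
      (s'.N 0 = 1 ↔ H.HasNonRainbowPlaneCycle) := by
  obtain ⟨s', h1, -, h2⟩ := flags_loops (c := (H.input e).natMem) (x := (H.input e).realMem)
    (ρ := fun r => if r = 1 then n else 1) (n := n) (by simp) (by simp)
    ([.natCopy 1 0, .natConst 2 1, .natConst 0 0].foldl Op.exec (H.input e))
    ⟨fun r h0 hr => by interval_cases r <;> simp [Op.exec, input], rfl, rfl⟩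
  refine ⟨s', h1.block.haltsWithin, ?_⟩
  rw [h2, exists_cycleAt_input_iff]
  simp [Op.exec]

end GeometricCompleteMultipartiteGraph

theorem theorem1 :
    (∀ (V : Type*) [Fintype V] (H : GeometricCompleteMultipartiteGraph V),
      H.HasNonRainbowPlaneCycle ↔
        (H.ContainsC1 ∨ H.ContainsC2 ∨ H.ContainsC3 ∨ H.ContainsC4)) ∧
    (∃ (P : RealRAM.Prog) (T : ℕ → ℕ),
      (fun n : ℕ => (T n : ℝ)) =O[Filter.atTop] (fun n : ℕ => (n : ℝ) ^ 5) ∧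
      ∀ (V : Type*) [Fintype V] (H : GeometricCompleteMultipartiteGraph V)
        (e : Fin (Fintype.card V) ≃ V),
        ∃ s' : RealRAM.Store,
          RealRAM.HaltsWithin P (H.input e) (T (Fintype.card V)) s' ∧
          (s'.N 0 = 1 ↔ H.HasNonRainbowPlaneCycle)) := by
  refine ⟨fun V _ H => H.hasNonRainbowPlaneCycle_iff, RealRAM.nonRainbowPlaneCycleProg,
    fun n => 416 * (n + 1) ^ 5 + 6, ?_, fun V _ H e => H.exists_haltsWithin_input e⟩
  refine Asymptotics.IsBigO.of_bound (416 * 2 ^ 5 + 6) ?_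
  filter_upwards [Filter.eventually_ge_atTop 1] with n hn
  have hn' : (1 : ℝ) ≤ n := by exact_mod_cast hn
  have h1 : ((n : ℝ) + 1) ^ 5 ≤ (2 * n) ^ 5 := by gcongr; linarith
  have h2 : (1 : ℝ) ≤ (n : ℝ) ^ 5 := one_le_pow₀ hn'
  rw [Real.norm_of_nonneg (by positivity), Real.norm_of_nonneg (by positivity)]
  push_cast
  rw [mul_pow] at h1
  linarith
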